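/- Let $d\ge 1$ and let $\mathbb T^d=[0,2\pi]^d$ with opposite faces identified. For $f\in L_2(\mathbb T^d)$ put $\|f\|_2=\big(\int_{\mathbb T^d}|f(x)|^2dx\big)^{1/2}$ and $c_\ell(f)=(2\pi)^{-d}\int_{\mathbb T^d}f(x)e^{-i\ell\cdot x}\,dx$, $\ell\in\mathbb Z^d$. For $k\in\mathbb N_0^d$ let $|k|_1=\sum_j k_j$, $|k|_\infty=\max_j k_j$ and $$\delta_k(f)=\sum_{\ell\in P_{k_1}\times\cdots\times P_{k_d}}c_\ell(f)e^{i\ell\cdot x},\qquad P_0=\{0\},\quad P_j=\{n\in\mathbb Z:2^{j-1}\le|n|<2^j\}\ (j\ge1).$$ For $\alpha,\beta\ge0$ let $H^{\alpha,\beta}(\mathbb T^d)$ be the space of all $f\in L_2(\mathbb T^d)$ with $\sum_{\ell\in\mathbb Z^d}|c_\ell(f)|^2\prod_{j=1}^d(1+|\ell_j|^2)^\alpha\,\big(1+\sum_{j=1}^d|\ell_j|^2\big)^\beta<\infty$, with the norm $$\|f\|_{H^{\alpha,\beta}(\mathbb T^d)}=\Big(\sum_{k\in\mathbb N_0^d}2^{2(\alpha|k|_1+\beta|k|_\infty)}\|\delta_k(f)\|_2^2\Big)^{1/2},$$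 and let $H^{\beta}(\mathbb T^d)=H^{0,\beta}(\mathbb T^d)$. For a function $h$ on $\mathbb T$ and $n\in\mathbb N_0$ let $$I_nh(t)=\frac1{2n+1}\sum_{\ell=0}^{2n}h(t_\ell^n)D_n(t-t_\ell^n),\qquad t_\ell^n=\frac{2\pi\ell}{2n+1},\qquad D_n(t)=\sum_{|k|\le n}e^{ikt},$$ and let $\eta_0=I_1$, $\eta_j=I_{2^j}-I_{2^{j-1}}$ for $j\ge1$, $q_k=\eta_{k_1}\otimes\cdots\otimes\eta_{k_d}$ for $k\in\mathbb N_0^d$. For $m\in\mathbb N$ the Smolyak operator is $Q_m=\sum_{k\in\mathbb N_0^d,\ |k|_1\le m}q_k$. **Theorem.** Let $\beta\ge0$ and $\alpha>\frac12$. Then every $f\in H^{\alpha,\beta}(\mathbb T^d)$ has a continuous representative, to which $Q_m$ is applied, and there is a constant $C=C(\alpha,\beta,d)>0$ such that for all $f\in H^{\alpha,\beta}(\mathbb T^d)$ and all $m\in\mathbb N=\{1,2,\dots\}$ we have $f-Q_mf\in H^\beta(\mathbb T^d)$ and $$\|f-Q_mf\|_{H^\beta(\mathbb T^d)}\le C\,2^{-m\alpha}\,m^{\frac{d-1}2}\,\|f\|_{H^{\alpha,\beta}(\mathbb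 T^d)}.$$ -/

import Mathlib

open Real MeasureTheory
open scoped ENNReal

noncomputable section

namespace SparseGrid

instance factTwoPiPos : Fact (0 < 2 * π) := ⟨Real.two_pi_pos⟩

/-- The `d`-torus `[0, 2π]^d` with opposite faces identified, carrying Lebesgue measure
(`volume`, of total mass `(2π)^d`). -/
abbrev Torus (d : ℕ) : Type := Fin d → AddCircle (2 * π)

/-! ### Fourier coefficients and Sobolev spaces -/

/-- The exponential `x ↦ e^{i k·x}`, `k ∈ ℤ^d`. -/
def expo {d : ℕ} (k : Fin d → ℤ) (x : Torus d) : ℂ := ∏ j, fourier (k j) (x j)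

/-- The Fourier coefficient `c_k(f) = (2π)^{-d} ∫ f(x) e^{-i k·x} dx`. -/
def coeff {d : ℕ} (f : Torus d → ℂ) (k : Fin d → ℤ) : ℂ :=
  (((2 * π) ^ d : ℝ) : ℂ)⁻¹ * ∫ x, f x * expo (-k) x

/-- `(∑_k |c_k(f)|² ∏_j (1 + |k_j|²)^α (1 + |k|₂²)^β)^{1/2}`, possibly infinite. -/
def sharpNorm {d : ℕ} (α β : ℝ) (f : Torus d → ℂ) : ℝ≥0∞ :=
  (∑' k : Fin d → ℤ, ENNReal.ofReal (‖coeff f k‖ ^ 2 *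
    ((∏ j, (1 + (k j : ℝ) ^ 2) ^ α) * (1 + ∑ j, (k j : ℝ) ^ 2) ^ β))) ^ (1 / 2 : ℝ)

/-- `f` belongs to the hybrid Sobolev space `H^{α,β}` on the torus. -/
def MemH {d : ℕ} (α β : ℝ) (f : Torus d → ℂ) : Prop :=
  MemLp f 2 ∧ sharpNorm α β f < ∞

/-- The dyadic block `P_0 = {0}`, `P_j = {ℓ ∈ ℤ : 2^{j-1} ≤ |ℓ| < 2^j}`. -/
def dyadicBlock (j : ℕ) : Finset ℤ :=
  if j = 0 then {0}
  else (Finset.Icc (-(2 ^ j : ℤ)) (2 ^ j)).filter fun l => 2 ^ (j - 1) ≤ |l| ∧ |l| < 2 ^ j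

/-- The part `δ_k(f)` of the Fourier series of `f` with frequencies in
`P_{k_1} × ⋯ × P_{k_d}`. -/
def dyadicPart {d : ℕ} (k : Fin d → ℕ) (f : Torus d → ℂ) (x : Torus d) : ℂ :=
  ∑ l ∈ Fintype.piFinset (fun j => dyadicBlock (k j)), coeff f l * expo l x

/-- `|k|_1` for `k ∈ ℕ₀^d`. -/
def oneNorm {d : ℕ} (k : Fin d → ℕ) : ℕ := ∑ j, k j

/-- `|k|_∞` for `k ∈ ℕ₀^d`. -/
def supNorm {d : ℕ} (k : Fin d → ℕ) : ℕ := Finset.univ.sup k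

/-- The norm `‖f‖_{H^{α,β}} = (∑_k 2^{2(α|k|_1 + β|k|_∞)} ‖δ_k(f)‖_2²)^{1/2}`,
possibly infinite. -/
def hybridNorm {d : ℕ} (α β : ℝ) (f : Torus d → ℂ) : ℝ≥0∞ :=
  (∑' k : Fin d → ℕ,
    ENNReal.ofReal ((2 : ℝ) ^ (2 * (α * (oneNorm k : ℝ) + β * (supNorm k : ℝ)))) *
      eLpNorm (dyadicPart k f) 2 volume ^ 2) ^ (1 / 2 : ℝ)

/-- `f` belongs to the isotropic Sobolev space `H^γ = H^{0,γ}`. -/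
def MemHIso {d : ℕ} (γ : ℝ) (f : Torus d → ℂ) : Prop := MemH 0 γ f

/-- The norm of the isotropic Sobolev space `H^γ = H^{0,γ}`. -/
def isoNorm {d : ℕ} (γ : ℝ) (f : Torus d → ℂ) : ℝ≥0∞ := hybridNorm 0 γ f

/-! ### Sampling operators -/

/-- The Dirichlet kernel `D_m(t) = ∑_{|k| ≤ m} e^{ikt}`. -/
def dirichletKernel (m : ℕ) (t : AddCircle (2 * π)) : ℂ :=
  ∑ k ∈ Finset.Icc (-(m : ℤ)) m, fourier k t

/-- The node `2πℓ/(2m+1)`. -/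
def node (m l : ℕ) : AddCircle (2 * π) := ((2 * π * l / (2 * m + 1) : ℝ) : AddCircle (2 * π))

/-- Trigonometric interpolation
`I_m f(t) = (2m+1)^{-1} ∑_{ℓ=0}^{2m} f(t_ℓ) D_m(t - t_ℓ)`. -/
def interp (m : ℕ) (f : AddCircle (2 * π) → ℂ) (t : AddCircle (2 * π)) : ℂ :=
  (2 * m + 1 : ℂ)⁻¹ *
    ∑ l ∈ Finset.range (2 * m + 1), f (node m l) * dirichletKernel m (t - node m l)

/-- `η_0 = I_1` and `η_m = I_{2^m} - I_{2^{m-1}}` for `m > 0`. -/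
def eta (m : ℕ) (f : AddCircle (2 * π) → ℂ) (t : AddCircle (2 * π)) : ℂ :=
  if m = 0 then interp 1 f t else interp (2 ^ m) f t - interp (2 ^ (m - 1)) f t

/-- The univariate operator `A` acting on the `j`-th variable of `f`, the other variables
being frozen. -/
def onCoord {d : ℕ} (A : (AddCircle (2 * π) → ℂ) → AddCircle (2 * π) → ℂ) (j : Fin d)
    (f : Torus d → ℂ) (x : Torus d) : ℂ :=
  A (fun t => f (Function.update x j t)) (x j)

/-- The tensor product `A_1 ⊗ ⋯ ⊗ A_d` of univariate operators: `A_j` is applied in the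
`j`-th variable, for every `j`. -/
def tensorOp {d : ℕ} (A : Fin d → (AddCircle (2 * π) → ℂ) → AddCircle (2 * π) → ℂ)
    (f : Torus d → ℂ) : Torus d → ℂ :=
  (List.finRange d).foldr (fun j g => onCoord (A j) j g) f

/-- `q_k = η_{k_1} ⊗ ⋯ ⊗ η_{k_d}`. -/
def q {d : ℕ} (k : Fin d → ℕ) (f : Torus d → ℂ) : Torus d → ℂ :=
  tensorOp (fun j => eta (k j)) f

/-- `Q_Δ = ∑_{k ∈ Δ} q_k`. -/
def samplingOp {d : ℕ} (Δ : Finset (Fin d → ℕ)) (f : Torus d → ℂ) (x : Torus d) : ℂ :=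
  ∑ k ∈ Δ, q k f x

/-- The index set `{k ∈ ℕ₀^d : |k|_1 ≤ m}` of the Smolyak algorithm. -/
def smolyakIndex (d m : ℕ) : Finset (Fin d → ℕ) :=
  (Fintype.piFinset fun _ => Finset.range (m + 1)).filter fun k => oneNorm k ≤ m

end SparseGrid

end

noncomputable section

namespace SparseGrid

/-! ### Fourier analysis on the torus -/

variable {d : ℕ}

/-! Since `α > 1/2`, Cauchy–Schwarz against `∏ 2^(-α·level l_j)` makes the Fourier coefficients of
`f` absolutely summable (`summable_coeff_of_tsum`). Hence `f` is almost everywhere the continuous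
sum of its Fourier series, and the sampling operators act on that series term by term (`q_tsum`).
Interpolation sends an exponential to the exponential of its balanced residue (`interp_fourier`), so
`q_k` has the explicit matrix `∏ etaCoeff`.

For a fixed frequency `l` the sum of these matrices over a large box telescopes to the identity. The
error is therefore carried by the indices `|k|_1 > m` (`enorm_sub_sum_smolyak_le`,
`enorm_coeff_error_le`). A nonzero entry `etaCoeff k l n` forces `k ≤ level l` and `level n ≤ k +
1`. So output frequencies exceed input levels by at most one, and the `β`-weight passes from `n` to
`l` at the cost of a factor `2^β` (`hybridWeight_zero_mul_enorm_coeff_error_le`).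

What remains is an `ℓ²` bound for a nonnegative kernel with input weight `∏ 2^(-α·level l_j)`,
proved by a weighted Schur test (`exists_tsum_error_kernel_le`). The weight is split around
`2^(-αk)`. One half must beat the roughly `2^(level l - k)` frequencies aliased to the same `n`, the
other only needs to be summable over `k ≤ level l`; `α > 1/2` leaves room for both. The leftover
factor is `∑_{|k|_1 > m} 2^(-2α|k|_1)`, of order `2^(-2αm) m^(d-1)` (`exists_tsum_simplex_tail_le`),
whose square root is the stated rate.

The estimates are carried out in `ℝ≥0∞`, where sums may be interchanged freely. -/

/-- The exponential `expo k` as a continuous function. -/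
def expoC (k : Fin d → ℤ) : C(Torus d, ℂ) where
  toFun := expo k
  continuous_toFun := by unfold expo; fun_prop

@[simp] lemma expoC_apply (k : Fin d → ℤ) (x : Torus d) : expoC k x = expo k x := rfl

lemma continuous_expo (k : Fin d → ℤ) : Continuous (expo k) := (expoC k).continuous

lemma norm_fourier_apply (n : ℤ) (t : AddCircle (2 * π)) : ‖(fourier n t : ℂ)‖ = 1 :=
  Circle.norm_coe _

@[simp] lemma norm_expo (k : Fin d → ℤ) (x : Torus d) : ‖expo k x‖ = 1 := by
  rw [expo, norm_prod]
  exact Finset.prod_eq_one fun j _ => norm_fourier_apply _ _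

lemma expo_zero (x : Torus d) : expo 0 x = 1 := by simp [expo]

lemma expo_neg (k : Fin d → ℤ) (x : Torus d) : expo (-k) x = star (expo k x) := by
  simp [expo]

lemma expo_add (k l : Fin d → ℤ) (x : Torus d) : expo (k + l) x = expo k x * expo l x := by
  simp [expo, Finset.prod_mul_distrib]

lemma expo_single (j : Fin d) (x : Torus d) : expo (Pi.single j 1) x = fourier 1 (x j) := by
  rw [expo, Finset.prod_eq_single j]
  · simp
  · intro i _ hi
    simp [Pi.single_eq_of_ne hi]
  · simp

/-- The star subalgebra of `C(Torus d, ℂ)` generated by the exponentials. -/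
def expoSubalgebra (d : ℕ) : StarSubalgebra ℂ C(Torus d, ℂ) where
  toSubalgebra := Algebra.adjoin ℂ (Set.range expoC)
  star_mem' := by
    change Algebra.adjoin ℂ (Set.range expoC) ≤ star (Algebra.adjoin ℂ (Set.range expoC))
    refine Algebra.adjoin_le ?_
    rintro _ ⟨n, rfl⟩
    refine Algebra.subset_adjoin ⟨-n, ?_⟩
    ext1 x
    simp only [expoC_apply, expo_neg, ContinuousMap.star_apply]

lemma expoSubalgebra_coe :
    (expoSubalgebra d).toSubalgebra.toSubmodule = Submodule.span ℂ (Set.range expoC) := by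
  apply Algebra.adjoin_eq_span_of_subset
  refine .trans (fun x ↦ Submonoid.closure_induction (fun _ ↦ id) ⟨0, ?_⟩ ?_)
    Submodule.subset_span
  · ext z
    simp [expo_zero]
  · rintro _ _ _ _ ⟨m, rfl⟩ ⟨n, rfl⟩
    refine ⟨m + n, ?_⟩
    ext z
    simp [expo_add]

lemma expoSubalgebra_separatesPoints : (expoSubalgebra d).SeparatesPoints := by
  intro x y hxy
  rw [Ne, funext_iff, not_forall] at hxy
  obtain ⟨i, hi⟩ := hxy
  refine ⟨_, ⟨expoC (Pi.single i 1), Algebra.subset_adjoin ⟨Pi.single i 1, rfl⟩, rfl⟩, ?_⟩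
  change expo (Pi.single i 1) x ≠ expo (Pi.single i 1) y
  rw [expo_single, expo_single, fourier_one, fourier_one]
  contrapose hi
  exact AddCircle.injective_toCircle Real.two_pi_pos.ne' (Subtype.ext hi)

/-- Stone–Weierstrass; products of exponentials are exponentials, so the generated algebra is
already their linear span. -/
lemma span_expoC_closure_eq_top :
    (Submodule.span ℂ (Set.range (expoC (d := d)))).topologicalClosure = ⊤ := by
  rw [← expoSubalgebra_coe]
  exact congr_arg (Subalgebra.toSubmodule <| StarSubalgebra.toSubalgebra ·)
    (ContinuousMap.starSubalgebra_topologicalClosure_eq_top_of_separatesPoints _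
      (expoSubalgebra_separatesPoints (d := d)))

lemma span_expoLp_closure_eq_top :
    (Submodule.span ℂ (Set.range fun k : Fin d → ℤ =>
      ContinuousMap.toLp (E := ℂ) 2 (volume : Measure (Torus d)) ℂ
        (expoC k))).topologicalClosure = ⊤ := by
  simpa only [Submodule.map_span, ContinuousLinearMap.coe_coe, ← Set.range_comp,
    Function.comp_def] using
    (ContinuousMap.toLp_denseRange ℂ (volume : Measure (Torus d)) ℂ
      (p := 2) (by simp)).topologicalClosure_map_submodule span_expoC_closure_eq_top

/-- A square integrable function all of whose Fourier coefficients vanish is zero. -/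
theorem ae_eq_zero_of_coeff_eq_zero {f : Torus d → ℂ} (hf : MemLp f 2)
    (h : ∀ k, coeff f k = 0) : f =ᵐ[volume] 0 := by
  have hortho : hf.toLp f ∈ (Submodule.span ℂ (Set.range fun k : Fin d → ℤ =>
      ContinuousMap.toLp (E := ℂ) 2 (volume : Measure (Torus d)) ℂ (expoC k)))ᗮ := by
    rw [Submodule.mem_orthogonal]
    intro u hu
    induction hu using Submodule.span_induction with
    | mem u hu =>
      obtain ⟨k, rfl⟩ := hu
      rw [L2.inner_def]
      have hk := h k
      rw [coeff, mul_eq_zero, or_iff_right (by simp [Real.pi_ne_zero])] at hk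
      rw [← hk]
      refine integral_congr_ae ?_
      filter_upwards [hf.coeFn_toLp, ContinuousMap.coeFn_toLp (p := 2) (𝕜 := ℂ)
        (volume : Measure (Torus d)) (expoC k)] with x hx hx'
      rw [hx, hx', RCLike.inner_apply, expo_neg]
      rfl
    | zero => simp
    | add u v _ _ hu hv => rw [inner_add_left, hu, hv, add_zero]
    | smul c u _ hu => rw [inner_smul_left, hu, mul_zero]
  -- The orthogonal complement of a dense subspace is trivial.
  rw [(Submodule.topologicalClosure_eq_top_iff).1 span_expoLp_closure_eq_top,
    Submodule.mem_bot] at hortho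
  have := hf.coeFn_toLp
  rw [hortho] at this
  filter_upwards [this, Lp.coeFn_zero ℂ 2 (volume : Measure (Torus d))] with x h1 h2
  rw [← h1, h2]

lemma integrable_mul_expo {f : Torus d → ℂ} (hf : Integrable f) (k : Fin d → ℤ) :
    Integrable fun x => f x * expo k x := by
  refine hf.mul_bdd (c := 1) (continuous_expo k).aestronglyMeasurable ?_
  simp

lemma coeff_sub {f g : Torus d → ℂ} (hf : Integrable f) (hg : Integrable g) (k : Fin d → ℤ) :
    coeff (fun x => f x - g x) k = coeff f k - coeff g k := by
  simp only [coeff, sub_mul]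
  rw [integral_sub (integrable_mul_expo hf _) (integrable_mul_expo hg _), mul_sub]

lemma coeff_finset_sum {ι : Type*} (s : Finset ι) {f : ι → Torus d → ℂ}
    (hf : ∀ i ∈ s, Integrable (f i)) (k : Fin d → ℤ) :
    coeff (fun x => ∑ i ∈ s, f i x) k = ∑ i ∈ s, coeff (f i) k := by
  simp only [coeff, Finset.sum_mul]
  rw [integral_finsetSum _ fun i hi => integrable_mul_expo (hf i hi) _, Finset.mul_sum]

/-- The univariate Fourier coefficient, normalised as in `coeff`. -/
def coeffOne (h : AddCircle (2 * π) → ℂ) (n : ℤ) : ℂ :=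
  ((2 * π : ℝ) : ℂ)⁻¹ * ∫ t, h t * fourier (-n) t

lemma coeff_prod (h : Fin d → AddCircle (2 * π) → ℂ) (n : Fin d → ℤ) :
    coeff (fun x => ∏ j, h j (x j)) n = ∏ j, coeffOne (h j) (n j) := by
  have : (∫ x : Torus d, (∏ j, h j (x j)) * expo (-n) x) =
      ∏ j, ∫ t, h j t * fourier (-(n j)) t := by
    rw [← integral_fintype_prod_volume_eq_prod]
    simp [expo, Finset.prod_mul_distrib]
  rw [coeff, this]
  simp only [coeffOne, Finset.prod_mul_distrib, Finset.prod_const, Finset.card_univ,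
    Fintype.card_fin]
  push_cast
  rw [inv_pow]

lemma coeffOne_fourier (k n : ℤ) :
    coeffOne (fun t => fourier k t) n = if k = n then 1 else 0 := by
  have h := congrFun (fourierCoeff_fourier (T := 2 * π) k) n
  rw [fourierCoeff, AddCircle.integral_haarAddCircle] at h
  rw [coeffOne]
  simp only [smul_eq_mul, Complex.real_smul] at h
  push_cast at h ⊢
  simp only [mul_comm (fourier k _ : ℂ)]
  rw [h, Pi.single_apply]
  simp [eq_comm]

lemma coeffOne_sub_fourier (k l n : ℤ) :
    coeffOne (fun t => fourier k t - fourier l t) n =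
      (if k = n then 1 else 0) - if l = n then 1 else 0 := by
  rw [← coeffOne_fourier, ← coeffOne_fourier]
  simp only [coeffOne, sub_mul]
  have hi : ∀ k : ℤ, Integrable fun t : AddCircle (2 * π) => fourier k t * (fourier (-n) t : ℂ) :=
    fun k => (Continuous.integrable_of_hasCompactSupport (by fun_prop)
      (HasCompactSupport.of_compactSpace _))
  rw [integral_sub (hi k) (hi l), mul_sub]

lemma coeff_expo (k n : Fin d → ℤ) : coeff (expo k) n = if k = n then 1 else 0 := by
  have : expo k = fun x : Torus d => ∏ j, (fun t => (fourier (k j) t : ℂ)) (x j) := rfl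
  rw [this, coeff_prod]
  simp only [coeffOne_fourier, Finset.prod_ite_zero, Finset.prod_const_one, Finset.mem_univ,
    true_implies, funext_iff]

lemma integrable_of_continuous {f : Torus d → ℂ} (hf : Continuous f) : Integrable f :=
  hf.integrable_of_hasCompactSupport (HasCompactSupport.of_compactSpace _)

/-- Fourier coefficients of an absolutely convergent series of uniformly bounded functions. -/
lemma coeff_tsum {ι : Type*} [Countable ι] {c : ι → ℂ} (hc : Summable fun i => ‖c i‖)
    {p : ι → Torus d → ℂ} (hp : ∀ i, Continuous (p i)) {B : ℝ} (hB : ∀ i x, ‖p i x‖ ≤ B)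
    (n : Fin d → ℤ) :
    HasSum (fun i => c i * coeff (p i) n) (coeff (fun x => ∑' i, c i * p i x) n) := by
  have hs : ∀ x, Summable fun i => c i * p i x := fun x =>
    Summable.of_norm_bounded (hc.mul_right B) fun i => by
      rw [norm_mul]; exact mul_le_mul_of_nonneg_left (hB i x) (norm_nonneg _)
  have := hasSum_integral_of_dominated_convergence (μ := (volume : Measure (Torus d)))
    (F := fun i x => c i * p i x * expo (-n) x) (f := fun x => (∑' i, c i * p i x) * expo (-n) x)
    (fun i _ => ‖c i‖ * B) (fun i => by
      have := (((hp i).const_mul (c i)).mul (continuous_expo (-n)))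
      exact (this.aestronglyMeasurable))
    (fun i => Filter.Eventually.of_forall fun x => by
      rw [norm_mul, norm_mul, norm_expo, mul_one]
      exact mul_le_mul_of_nonneg_left (hB i x) (norm_nonneg _))
    (Filter.Eventually.of_forall fun x => hc.mul_right B)
    (integrable_const _)
    (Filter.Eventually.of_forall fun x => (hs x).hasSum.mul_right _)
  have h2 := this.mul_left ((((2 * π) ^ d : ℝ) : ℂ)⁻¹)
  rw [← coeff] at h2
  refine h2.congr_fun fun i => ?_
  simp only [coeff, mul_assoc, integral_const_mul]
  ring

lemma continuous_tsum_mul {ι : Type*} {c : ι → ℂ} (hc : Summable fun i => ‖c i‖)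
    {p : ι → Torus d → ℂ} (hp : ∀ i, Continuous (p i)) {B : ℝ} (hB : ∀ i x, ‖p i x‖ ≤ B) :
    Continuous fun x => ∑' i, c i * p i x := by
  refine continuous_tsum (fun i => (hp i).const_mul _) (hc.mul_right B) fun i x => ?_
  rw [norm_mul]
  exact mul_le_mul_of_nonneg_left (hB i x) (norm_nonneg _)

lemma memLp_of_continuous {f : Torus d → ℂ} (hf : Continuous f) (p : ℝ≥0∞) : MemLp f p :=
  hf.memLp_of_hasCompactSupport (HasCompactSupport.of_compactSpace _)

/-- A square integrable function with absolutely summable Fourier coefficients is almost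
everywhere the sum of its Fourier series. -/
theorem ae_eq_tsum_coeff {f : Torus d → ℂ} (hf : MemLp f 2)
    (hc : Summable fun k => ‖coeff f k‖) :
    f =ᵐ[volume] fun x => ∑' k, coeff f k * expo k x := by
  have hG : Continuous fun x => ∑' k, coeff f k * expo k x :=
    continuous_tsum_mul hc continuous_expo (B := 1) (by simp)
  have h := ae_eq_zero_of_coeff_eq_zero (f := fun x => f x - ∑' k, coeff f k * expo k x)
    (hf.sub (memLp_of_continuous hG 2)) fun n => by
      rw [coeff_sub (hf.integrable (by norm_num)) (integrable_of_continuous hG),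
        (coeff_tsum hc continuous_expo (B := 1) (by simp) n).unique
          (hasSum_single n fun k hk => by simp [coeff_expo, hk]), coeff_expo, if_pos rfl, mul_one,
        sub_self]
  filter_upwards [h] with x hx
  exact sub_eq_zero.1 hx

/-- Orthogonality: the `L²` norm of a trigonometric polynomial. -/
lemma eLpNorm_sum_expo_sq (s : Finset (Fin d → ℤ)) (c : (Fin d → ℤ) → ℂ) :
    eLpNorm (fun x : Torus d => ∑ l ∈ s, c l * expo l x) 2 volume ^ 2 =
      ENNReal.ofReal ((2 * π) ^ d) * ∑ l ∈ s, ENNReal.ofReal (‖c l‖ ^ 2) := by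
  set P : Torus d → ℂ := fun x => ∑ l ∈ s, c l * expo l x with hP
  have hPc : Continuous P := continuous_finsetSum _ fun l _ => (continuous_expo l).const_mul _
  have hint : ∫ x, (‖P x‖ ^ 2 : ℝ) = (2 * π) ^ d * ∑ l ∈ s, ‖c l‖ ^ 2 := by
    have hcoef : ∀ n, coeff P n = if n ∈ s then c n else 0 := fun n => by
      rw [hP, coeff_finset_sum s fun l _ =>
        integrable_of_continuous ((continuous_expo l).const_mul _)]
      have : ∀ l, coeff (fun x => c l * expo l x) n = c l * if l = n then 1 else 0 := fun l => by
        rw [← coeff_expo]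
        simp only [coeff, mul_assoc, integral_const_mul]
        ring
      simp [this]
    -- Expanding only the conjugate factor reduces the integral to the Fourier coefficients of `P`,
    -- already known from `hcoef`.
    have hprod : ∀ x, ((‖P x‖ ^ 2 : ℝ) : ℂ) = ∑ l ∈ s, star (c l) * (P x * expo (-l) x) := by
      intro x
      have : ((‖P x‖ ^ 2 : ℝ) : ℂ) = P x * star (P x) := by
        rw [← Complex.normSq_eq_norm_sq, ← Complex.mul_conj]; rfl
      rw [this]
      conv_lhs => rw [hP]
      simp only [star_sum, star_mul', ← expo_neg, Finset.mul_sum]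
      exact Finset.sum_congr rfl fun l _ => by ring
    have hC : ((∫ x, (‖P x‖ ^ 2 : ℝ) : ℝ) : ℂ) =
        (((2 * π) ^ d * ∑ l ∈ s, ‖c l‖ ^ 2 : ℝ) : ℂ) := by
      rw [← integral_complex_ofReal]
      simp only [hprod]
      rw [integral_finsetSum _ fun l _ =>
        (integrable_mul_expo (integrable_of_continuous hPc) _).const_mul _]
      push_cast
      rw [Finset.mul_sum]
      refine Finset.sum_congr rfl fun l hl => ?_
      rw [integral_const_mul]
      have h1 := hcoef l
      rw [if_pos hl, coeff, inv_mul_eq_iff_eq_mul₀ (by simp [Real.pi_ne_zero])] at h1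
      rw [h1, ← Complex.mul_conj']
      push_cast
      change (starRingEnd ℂ) (c l) * _ = _
      ring
    exact_mod_cast hC
  rw [← ENNReal.ofReal_sum_of_nonneg fun _ _ => by positivity,
    ← ENNReal.ofReal_mul (by positivity), ← hint,
    ofReal_integral_eq_lintegral_ofReal (integrable_of_continuous (f := fun x => ((‖P x‖ : ℂ)^2))
      (by fun_prop) |>.re.congr (Filter.Eventually.of_forall fun x => by
        simp [← Complex.ofReal_pow])) (Filter.Eventually.of_forall fun x => by positivity),
    eLpNorm_eq_lintegral_rpow_enorm_toReal (by simp) (by simp)]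
  simp only [ENNReal.toReal_ofNat]
  rw [← ENNReal.rpow_natCast, ← ENNReal.rpow_mul]
  norm_num

/-! ### Trigonometric interpolation of exponentials -/

lemma fourier_node (k : ℤ) (m l : ℕ) :
    (fourier k (node m l) : ℂ) = (Complex.exp (2 * π * Complex.I / (2 * m + 1 : ℕ)) ^ k) ^ l := by
  rw [node, fourier_coe_apply, ← Complex.exp_int_mul, ← Complex.exp_nat_mul]
  congr 1
  have h1 : (2 * m + 1 : ℂ) ≠ 0 := by exact_mod_cast Nat.succ_ne_zero (2 * m)
  have h2 : (π : ℂ) ≠ 0 := by exact_mod_cast Real.pi_ne_zero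
  push_cast
  field_simp

/-- A geometric sum over the powers of a primitive `(2m+1)`-th root of unity. -/
lemma sum_fourier_node (k : ℤ) (m : ℕ) :
    ∑ l ∈ Finset.range (2 * m + 1), (fourier k (node m l) : ℂ) =
      if ((2 * m + 1 : ℕ) : ℤ) ∣ k then (2 * m + 1 : ℂ) else 0 := by
  have hζ := Complex.isPrimitiveRoot_exp (2 * m + 1) (by omega)
  simp only [fourier_node]
  set ζ := Complex.exp (2 * π * Complex.I / (2 * m + 1 : ℕ))
  split_ifs with h
  · rw [(hζ.zpow_eq_one_iff_dvd k).2 h]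
    simp
  · have hne : ζ ^ k ≠ 1 := fun h1 => h ((hζ.zpow_eq_one_iff_dvd k).1 h1)
    rw [geom_sum_eq hne, ← zpow_natCast, ← zpow_mul, mul_comm, zpow_mul, zpow_natCast,
      hζ.pow_eq_one]
    simp

lemma fourier_sub_apply (k : ℤ) (t y : AddCircle (2 * π)) :
    (fourier k (t - y) : ℂ) = fourier k t * fourier (-k) y := by
  have h : k • (t - y) = k • t + (-k) • y := by rw [smul_sub, neg_smul, sub_eq_add_neg]
  change ((AddCircle.toCircle (k • (t - y)) : Circle) : ℂ) = _
  rw [h, AddCircle.toCircle_add, Circle.coe_mul]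
  rfl

/-- Aliasing: interpolation replaces a frequency by its balanced residue. -/
lemma interp_fourier (m : ℕ) (l : ℤ) (t : AddCircle (2 * π)) :
    interp m (fun s => fourier l s) t = fourier (l.bmod (2 * m + 1)) t := by
  have h0 : (2 * m + 1 : ℂ) ≠ 0 := by exact_mod_cast Nat.succ_ne_zero (2 * m)
  have hr := Int.le_bmod (x := l) (m := 2 * m + 1) (by omega)
  have hr' := Int.bmod_lt (x := l) (m := 2 * m + 1) (by omega)
  have key : ∀ k ∈ Finset.Icc (-(m : ℤ)) m,
      (∑ i ∈ Finset.range (2 * m + 1), (fourier (l + -k) (node m i) : ℂ)) =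
        if k = l.bmod (2 * m + 1) then (2 * m + 1 : ℂ) else 0 := fun k hk => by
    rw [Finset.mem_Icc] at hk
    rw [sum_fourier_node]
    refine if_congr ⟨fun h => ?_, fun h => ?_⟩ rfl rfl
    · have h1 := Int.dvd_bmod_sub_self (x := l) (m := 2 * m + 1)
      have h2 := Int.dvd_add h h1
      obtain ⟨c, hc⟩ := h2
      -- Here `(2m+1)·c` is the difference of two integers in `[-m, m]`, so it has modulus at most
      -- `2m`.
      have hb : -(1 : ℤ) < c ∧ c < 1 := by
        push_cast at hc hr hr'
        constructor <;> nlinarith [show (l.bmod (2 * m + 1) : ℤ) ≤ m by omega,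
          show -(m : ℤ) ≤ l.bmod (2 * m + 1) by omega]
      obtain rfl : c = 0 := by omega
      omega
    · rw [h, ← sub_eq_add_neg]
      exact Int.dvd_self_sub_bmod
  calc interp m (fun s => fourier l s) t
      = (2 * m + 1 : ℂ)⁻¹ * ∑ k ∈ Finset.Icc (-(m : ℤ)) m, fourier k t *
          ∑ i ∈ Finset.range (2 * m + 1), (fourier (l + -k) (node m i) : ℂ) := by
        simp only [interp, dirichletKernel, fourier_sub_apply, Finset.mul_sum, fourier_add]
        rw [Finset.sum_comm]
        exact Finset.sum_congr rfl fun k _ => Finset.sum_congr rfl fun i _ => by ring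
    _ = fourier (l.bmod (2 * m + 1)) t := by
        rw [Finset.sum_congr rfl fun k hk => by rw [key k hk]]
        simp only [mul_ite, mul_zero]
        rw [Finset.sum_ite_eq', if_pos (Finset.mem_Icc.2 (by push_cast at hr hr'; omega))]
        field_simp

/-! ### Operators commuting with pointwise convergent series -/

/-- An operator on functions that is homogeneous and commutes with pointwise convergent series. -/
structure PreservesSums {X : Type*} (A : (X → ℂ) → X → ℂ) : Prop where
  hasSum : ∀ {ι : Type} (F : ι → X → ℂ) (f : X → ℂ), (∀ x, HasSum (fun i => F i x) (f x)) →
    ∀ x, HasSum (fun i => A (F i) x) (A f x)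
  const_mul : ∀ (c : ℂ) (f : X → ℂ) (x : X), A (fun y => c * f y) x = c * A f x

/-- Interpolation reads finitely many point values, so pointwise convergence suffices. -/
lemma preservesSums_interp (m : ℕ) : PreservesSums (interp m) where
  hasSum _ _ h t := (hasSum_sum fun l _ => (h (node m l)).mul_right _).mul_left _
  const_mul c f t := by
    simp only [interp, Finset.mul_sum]
    exact Finset.sum_congr rfl fun _ _ => by ring

lemma preservesSums_eta (k : ℕ) : PreservesSums (eta k) where
  hasSum F f h t := by
    by_cases hk : k = 0
    · simpa only [eta, if_pos hk] using (preservesSums_interp 1).hasSum F f h t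
    · simpa only [eta, if_neg hk] using ((preservesSums_interp _).hasSum F f h t).sub
        ((preservesSums_interp _).hasSum F f h t)
  const_mul c _ t := by
    simp only [eta, (preservesSums_interp _).const_mul, ← mul_sub, mul_ite]

lemma PreservesSums.onCoord {A : (AddCircle (2 * π) → ℂ) → AddCircle (2 * π) → ℂ}
    (hA : PreservesSums A) (j : Fin d) : PreservesSums (onCoord A j) where
  hasSum F _ h x := hA.hasSum (fun i t => F i (Function.update x j t)) _ (fun _ => h _) _
  const_mul c f x := hA.const_mul c (fun t => f (Function.update x j t)) _

lemma PreservesSums.foldr_onCoord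
    {A : Fin d → (AddCircle (2 * π) → ℂ) → AddCircle (2 * π) → ℂ}
    (hA : ∀ j, PreservesSums (A j)) (L : List (Fin d)) :
    PreservesSums fun f : Torus d → ℂ => L.foldr (fun j g => SparseGrid.onCoord (A j) j g) f := by
  induction L with
  | nil => exact ⟨fun _ _ h => h, fun _ _ _ => rfl⟩
  | cons j L ih =>
    refine ⟨fun F f h => ((hA j).onCoord j).hasSum _ _ (ih.hasSum F f h), fun c f x => ?_⟩
    have : (List.foldr (fun j g => SparseGrid.onCoord (A j) j g) (fun y => c * f y) L) =
        fun y => c * List.foldr (fun j g => SparseGrid.onCoord (A j) j g) f L y :=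
      funext fun y => ih.const_mul c f y
    simp only [List.foldr_cons, this]
    exact ((hA j).onCoord j).const_mul _ _ _

/-- With the other variables frozen, the remaining factors are a constant that homogeneity pulls
out. `Nodup` ensures that no coordinate is acted on twice. -/
lemma foldr_onCoord_prod {A : Fin d → (AddCircle (2 * π) → ℂ) → AddCircle (2 * π) → ℂ}
    (hA : ∀ j, PreservesSums (A j)) (φ : Fin d → AddCircle (2 * π) → ℂ) (L : List (Fin d))
    (hL : L.Nodup) (x : Torus d) :
    L.foldr (fun j g => onCoord (A j) j g) (fun x => ∏ j, φ j (x j)) x =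
      ∏ j, if j ∈ L then A j (φ j) (x j) else φ j (x j) := by
  induction L generalizing x with
  | nil => simp
  | cons i L ih =>
    rw [List.nodup_cons] at hL
    rw [List.foldr_cons, onCoord]
    have h1 : ∀ t, List.foldr (fun j g => onCoord (A j) j g) (fun x => ∏ j, φ j (x j)) L
        (Function.update x i t) =
        (∏ j ∈ Finset.univ.erase i, if j ∈ L then A j (φ j) (x j) else φ j (x j)) * φ i t := by
      intro t
      rw [ih hL.2, ← Finset.prod_erase_mul _ _ (Finset.mem_univ i)]
      simp only [Function.update_self, if_neg hL.1]
      congr 1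
      refine Finset.prod_congr rfl fun j hj => ?_
      rw [Function.update_of_ne (Finset.ne_of_mem_erase hj)]
    simp only [h1, (hA i).const_mul]
    rw [← Finset.prod_erase_mul _ _ (Finset.mem_univ i)]
    simp only [List.mem_cons, true_or, if_true]
    congr 1
    refine Finset.prod_congr rfl fun j hj => ?_
    simp [Finset.ne_of_mem_erase hj]

lemma preservesSums_q (k : Fin d → ℕ) : PreservesSums (q k) :=
  PreservesSums.foldr_onCoord (fun j => preservesSums_eta (k j)) _

lemma q_expo (k : Fin d → ℕ) (l : Fin d → ℤ) (x : Torus d) :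
    q k (expo l) x = ∏ j, eta (k j) (fun t => fourier (l j) t) (x j) := by
  have := foldr_onCoord_prod (fun j => preservesSums_eta (k j)) (fun j t => (fourier (l j) t : ℂ))
    (List.finRange d) (List.nodup_finRange d) x
  simp only [List.mem_finRange, if_true] at this
  exact this

/-- The Fourier coefficients of `η_k` applied to the exponential of frequency `l`. -/
def etaCoeff (k : ℕ) (l n : ℤ) : ℤ :=
  if k = 0 then (if l.bmod 3 = n then 1 else 0)
  else (if l.bmod (2 * 2 ^ k + 1) = n then 1 else 0) -
    if l.bmod (2 * 2 ^ (k - 1) + 1) = n then 1 else 0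

lemma coeffOne_eta_fourier (k : ℕ) (l n : ℤ) :
    coeffOne (eta k fun t => fourier l t) n = etaCoeff k l n := by
  by_cases hk : k = 0
  · have : (eta k fun t => (fourier l t : ℂ)) = fun t => (fourier (l.bmod 3) t : ℂ) := by
      funext t
      rw [eta, if_pos hk, interp_fourier]
    rw [this, coeffOne_fourier, etaCoeff, if_pos hk]
    push_cast
    rfl
  · have : (eta k fun t => (fourier l t : ℂ)) = fun t =>
        (fourier (l.bmod (2 * 2 ^ k + 1)) t : ℂ) - fourier (l.bmod (2 * 2 ^ (k - 1) + 1)) t := by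
      funext t
      rw [eta, if_neg hk, interp_fourier, interp_fourier]
    rw [this, coeffOne_sub_fourier, etaCoeff, if_neg hk]
    push_cast
    rfl

lemma eta_fourier_continuous (k : ℕ) (l : ℤ) : Continuous (eta k fun t => (fourier l t : ℂ)) := by
  unfold eta
  split_ifs <;> simp only [interp_fourier] <;> fun_prop

lemma norm_eta_fourier_le (k : ℕ) (l : ℤ) (t : AddCircle (2 * π)) :
    ‖eta k (fun t => (fourier l t : ℂ)) t‖ ≤ 2 := by
  unfold eta
  split_ifs <;> simp only [interp_fourier]
  · rw [norm_fourier_apply]; norm_num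
  · refine (norm_sub_le _ _).trans ?_
    rw [norm_fourier_apply, norm_fourier_apply]; norm_num

lemma continuous_q_expo (k : Fin d → ℕ) (l : Fin d → ℤ) : Continuous (q k (expo l)) := by
  rw [funext (q_expo k l)]
  exact continuous_finsetProd _ fun j _ => (eta_fourier_continuous _ _).comp (continuous_apply j)

lemma norm_q_expo_le (k : Fin d → ℕ) (l : Fin d → ℤ) (x : Torus d) : ‖q k (expo l) x‖ ≤ 2 ^ d := by
  rw [q_expo, norm_prod]
  refine (Finset.prod_le_prod (fun _ _ => norm_nonneg _)
    fun j _ => norm_eta_fourier_le _ _ _).trans ?_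
  simp

lemma coeff_q_expo (k : Fin d → ℕ) (l n : Fin d → ℤ) :
    coeff (q k (expo l)) n = ∏ j, (etaCoeff (k j) (l j) (n j) : ℂ) := by
  rw [funext (q_expo k l), coeff_prod]
  simp only [coeffOne_eta_fourier]

lemma q_tsum {c : (Fin d → ℤ) → ℂ} (hc : Summable fun l => ‖c l‖) {g : Torus d → ℂ}
    (hg : ∀ x, g x = ∑' l, c l * expo l x) (k : Fin d → ℕ) (x : Torus d) :
    q k g x = ∑' l, c l * q k (expo l) x := by
  have h : ∀ x, HasSum (fun l => c l * expo l x) (g x) := fun x => by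
    rw [hg x]
    exact (Summable.of_norm_bounded hc fun l => by simp).hasSum
  have := (preservesSums_q k).hasSum (fun l x => c l * expo l x) g h x
  simp only [(preservesSums_q k).const_mul] at this
  exact this.tsum_eq.symm

lemma continuous_q_of_tsum {c : (Fin d → ℤ) → ℂ} (hc : Summable fun l => ‖c l‖)
    {g : Torus d → ℂ} (hg : ∀ x, g x = ∑' l, c l * expo l x) (k : Fin d → ℕ) :
    Continuous (q k g) := by
  rw [funext (q_tsum hc hg k)]
  exact continuous_tsum_mul hc (continuous_q_expo k) (norm_q_expo_le k)

lemma hasSum_coeff_q {c : (Fin d → ℤ) → ℂ} (hc : Summable fun l => ‖c l‖)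
    {g : Torus d → ℂ} (hg : ∀ x, g x = ∑' l, c l * expo l x) (k : Fin d → ℕ)
    (n : Fin d → ℤ) :
    HasSum (fun l => c l * ∏ j, (etaCoeff (k j) (l j) (n j) : ℂ)) (coeff (q k g) n) := by
  rw [funext (q_tsum hc hg k)]
  simpa only [coeff_q_expo] using
    coeff_tsum hc (continuous_q_expo k) (norm_q_expo_le k) n

/-! ### Arithmetic of the aliasing coefficients -/

/-- The index of the dyadic block containing `l`. -/
def level (l : ℤ) : ℕ := l.natAbs.size

lemma level_le_iff {l : ℤ} {k : ℕ} : level l ≤ k ↔ |l| < 2 ^ k := by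
  rw [level, Nat.size_le, ← Int.natCast_natAbs]
  norm_cast

lemma lt_level_iff {l : ℤ} {k : ℕ} : k < level l ↔ 2 ^ k ≤ |l| := by
  rw [level, Nat.lt_size, ← Int.natCast_natAbs]
  norm_cast

lemma mem_dyadicBlock {l : ℤ} {k : ℕ} : l ∈ dyadicBlock k ↔ level l = k := by
  unfold dyadicBlock
  split_ifs with hk
  · subst hk
    rw [Finset.mem_singleton, ← Nat.le_zero, level_le_iff, pow_zero, Int.abs_lt_one_iff]
  · rw [Finset.mem_filter, Finset.mem_Icc, le_antisymm_iff, level_le_iff]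
    have h : k ≤ level l ↔ 2 ^ (k - 1) ≤ |l| := by
      rw [← lt_level_iff]
      omega
    rw [h]
    constructor
    · rintro ⟨-, h1, h2⟩
      exact ⟨h2, h1⟩
    · rintro ⟨h2, h1⟩
      exact ⟨abs_le.1 h2.le, h1, h2⟩

lemma bmod_eq_self_of_abs_le {l : ℤ} {m : ℕ} (h : |l| ≤ m) : l.bmod (2 * m + 1) = l := by
  rw [abs_le] at h
  rw [Int.bmod_eq_iff (by omega)]
  push_cast
  refine ⟨by omega, by omega, ?_⟩
  simp

lemma abs_bmod_le (l : ℤ) (m : ℕ) : |l.bmod (2 * m + 1)| ≤ m := by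
  have hr := Int.le_bmod (x := l) (m := 2 * m + 1) (by omega)
  have hr' := Int.bmod_lt (x := l) (m := 2 * m + 1) (by omega)
  push_cast at hr hr'
  rw [abs_le]
  omega

/-- Both interpolation operators in `η_k` reproduce such a frequency exactly, so their difference
kills it. -/
lemma etaCoeff_eq_zero_of_level_lt {k : ℕ} {l : ℤ} (h : level l < k) (n : ℤ) :
    etaCoeff k l n = 0 := by
  have hk : k ≠ 0 := by omega
  have h1 : |l| < 2 ^ (k - 1) := level_le_iff.1 (by omega)
  have h2 : (2 : ℤ) ^ (k - 1) ≤ 2 ^ k := pow_le_pow_right₀ (by norm_num) (by omega)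
  rw [etaCoeff, if_neg hk, bmod_eq_self_of_abs_le (by push_cast; omega),
    bmod_eq_self_of_abs_le (by push_cast; omega), sub_self]

lemma le_level_of_etaCoeff_ne_zero {k : ℕ} {l n : ℤ} (h : etaCoeff k l n ≠ 0) : k ≤ level l := by
  by_contra! hlt
  exact h (etaCoeff_eq_zero_of_level_lt hlt n)

/-- A balanced residue modulo `2·2^k + 1` may equal `±2^k`, which already has level `k + 1`; hence
the extra one. -/
lemma level_le_of_etaCoeff_ne_zero {k : ℕ} {l n : ℤ} (h : etaCoeff k l n ≠ 0) :
    level n ≤ k + 1 := by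
  rw [level_le_iff, pow_succ]
  have hpos : (0 : ℤ) < 2 ^ k := by positivity
  suffices |n| ≤ 2 ^ k by omega
  unfold etaCoeff at h
  split_ifs at h with hk h3 h1 h2 h2
  · rw [← h3, hk]
    simpa using abs_bmod_le l 1
  · exact absurd rfl h
  · rw [← h1]
    exact_mod_cast abs_bmod_le l (2 ^ k)
  · rw [← h1]
    exact_mod_cast abs_bmod_le l (2 ^ k)
  · rw [← h2]
    refine (show _ ≤ ((2 : ℤ) ^ (k - 1)) from by exact_mod_cast abs_bmod_le l (2 ^ (k - 1))).trans
      (pow_le_pow_right₀ (by norm_num) (by omega))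
  · simp at h

/-- The coefficients of `η_0, …, η_M` telescope. -/
lemma sum_etaCoeff (M : ℕ) (l n : ℤ) :
    ∑ k ∈ Finset.range (M + 1), etaCoeff k l n =
      if l.bmod (2 * 2 ^ M + 1) = n then 1 else 0 := by
  induction M with
  | zero => simp [etaCoeff]
  | succ M ih =>
    rw [Finset.sum_range_succ, ih, etaCoeff, if_neg (Nat.succ_ne_zero M)]
    simp only [Nat.add_sub_cancel]
    ring

lemma sum_etaCoeff_of_level_le {M : ℕ} {l : ℤ} (h : level l ≤ M) (n : ℤ) :
    ∑ k ∈ Finset.range (M + 1), etaCoeff k l n = if l = n then 1 else 0 := by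
  rw [sum_etaCoeff, bmod_eq_self_of_abs_le]
  have := level_le_iff.1 h
  push_cast
  omega

/-- The modulus of `etaCoeff`, as an extended nonnegative real. -/
def etaAbs (k : ℕ) (l n : ℤ) : ℝ≥0∞ := ‖etaCoeff k l n‖ₑ

lemma etaAbs_eq_zero_of_level_lt {k : ℕ} {l : ℤ} (h : level l < k) (n : ℤ) :
    etaAbs k l n = 0 := by
  rw [etaAbs, etaCoeff_eq_zero_of_level_lt h, enorm_zero]

lemma etaCoeff_ne_zero_of_etaAbs {k : ℕ} {l n : ℤ} (h : etaAbs k l n ≠ 0) :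
    etaCoeff k l n ≠ 0 := fun h' => h (by rw [etaAbs, h', enorm_zero])

/-- Indicator of `l` being aliased to `n` by interpolation with `2m+1` nodes. -/
def aliasInd (m : ℕ) (l n : ℤ) : ℝ≥0∞ := if l.bmod (2 * m + 1) = n then 1 else 0

lemma tsum_aliasInd (m : ℕ) (l : ℤ) : ∑' n, aliasInd m l n = 1 := by
  simp only [aliasInd]
  rw [tsum_eq_single (l.bmod (2 * m + 1)) fun n hn => if_neg hn.symm, if_pos rfl]

/-- For `k = 0` truncated subtraction makes the two terms on the right equal; the overcount is
harmless. -/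
lemma etaAbs_le (k : ℕ) (l n : ℤ) :
    etaAbs k l n ≤ aliasInd (2 ^ k) l n + aliasInd (2 ^ (k - 1)) l n := by
  unfold etaAbs etaCoeff aliasInd
  split_ifs with hk
  all_goals simp_all [enorm]

lemma tsum_etaAbs_le (k : ℕ) (l : ℤ) : ∑' n, etaAbs k l n ≤ 2 := by
  refine (ENNReal.tsum_le_tsum fun n => etaAbs_le k l n).trans ?_
  rw [ENNReal.tsum_add, tsum_aliasInd, tsum_aliasInd]
  norm_num

/-- The number of frequencies in a symmetric interval that are aliased to `n`. -/
lemma card_aliased_le (m N : ℕ) (n : ℤ) :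
    ((((Finset.Ico (-(N : ℤ)) N).filter fun l => l.bmod (2 * m + 1) = n).card : ℕ) : ℝ) ≤
      2 * N / (2 * m + 1) + 1 := by
  -- Frequencies aliased to `n` lie in one residue class, whose members in an interval are counted
  -- by a difference of ceilings.
  have hsub : ((Finset.Ico (-(N : ℤ)) N).filter fun l => l.bmod (2 * m + 1) = n) ⊆
      (Finset.Ico (-(N : ℤ)) N).filter fun l => l ≡ n [ZMOD ((2 * m + 1 : ℕ) : ℤ)] := by
    intro l hl
    rw [Finset.mem_filter] at hl ⊢
    refine ⟨hl.1, ?_⟩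
    rw [Int.modEq_iff_dvd, ← hl.2]
    exact Int.dvd_bmod_sub_self
  have h1 := Int.Ico_filter_modEq_card (-(N : ℤ)) N (r := ((2 * m + 1 : ℕ) : ℤ)) (by omega) n
  have h2 : (((Finset.Ico (-(N : ℤ)) N).filter
      fun l => l ≡ n [ZMOD ((2 * m + 1 : ℕ) : ℤ)]).card : ℚ) ≤ 2 * N / (2 * m + 1) + 1 := by
    have h3 := congrArg (Int.cast : ℤ → ℚ) h1
    push_cast at h3
    push_cast
    rw [h3]
    refine max_le ?_ (by positivity)
    have h4 := Int.ceil_lt_add_one (((N : ℚ) - n) / (2 * m + 1))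
    have h5 := Int.le_ceil ((-(N : ℚ) - n) / (2 * m + 1))
    have h6 : 2 * (N : ℚ) / (2 * m + 1) =
      ((N : ℚ) - n) / (2 * m + 1) - (-(N : ℚ) - n) / (2 * m + 1) := by field_simp; ring
    rw [h6]
    linarith
  have h7 := (Rat.cast_le (K := ℝ)).2
    (((Nat.cast_le (α := ℚ)).2 (Finset.card_le_card hsub)).trans h2)
  push_cast at h7
  exact h7

lemma tsum_aliasInd_level_le (m L : ℕ) (n : ℤ) :
    ∑' l, (if level l = L then aliasInd m l n else 0) ≤
      ENNReal.ofReal (2 * 2 ^ L / (2 * m + 1) + 1) := by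
  have hsupp : ∀ l : ℤ, l ∉ ((Finset.Ico (-((2 ^ L : ℕ) : ℤ)) (2 ^ L : ℕ)).filter
      fun l => l.bmod (2 * m + 1) = n) → (if level l = L then aliasInd m l n else 0) = 0 := by
    intro l hl
    by_cases h1 : level l = L
    · rw [if_pos h1, aliasInd, if_neg]
      intro h2
      have h3 := abs_lt.1 (level_le_iff.1 h1.le)
      refine hl (Finset.mem_filter.2 ⟨Finset.mem_Ico.2 ?_, h2⟩)
      push_cast
      omega
    · rw [if_neg h1]
  rw [tsum_eq_sum hsupp]
  calc _ ≤ ∑ l ∈ ((Finset.Ico (-((2 ^ L : ℕ) : ℤ)) (2 ^ L : ℕ)).filter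
      fun l => l.bmod (2 * m + 1) = n), (1 : ℝ≥0∞) := Finset.sum_le_sum fun l _ => by
        unfold aliasInd
        split_ifs <;> simp
    _ ≤ _ := by
        rw [Finset.sum_const, nsmul_one, ← ENNReal.ofReal_natCast]
        have := card_aliased_le m (2 ^ L) n
        push_cast at this
        exact ENNReal.ofReal_le_ofReal this

lemma tsum_etaAbs_level_le (k i : ℕ) (n : ℤ) :
    ∑' l, (if level l = k + i then etaAbs k l n else 0) ≤ 5 * 2 ^ i := by
  calc _ ≤ ∑' l, ((if level l = k + i then aliasInd (2 ^ k) l n else 0) +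
        if level l = k + i then aliasInd (2 ^ (k - 1)) l n else 0) :=
        ENNReal.tsum_le_tsum fun l => by
          split_ifs
          · exact etaAbs_le k l n
          · simp
    -- The counts are at most `2^i + 1` for order `2^k` and `2·2^i + 1` for order `2^(k-1)`; each
    -- `1` is absorbed into `2^i`.
    _ ≤ ENNReal.ofReal (2 * 2 ^ i) + ENNReal.ofReal (3 * 2 ^ i) := by
        rw [ENNReal.tsum_add]
        have hi : (1 : ℝ) ≤ 2 ^ i := one_le_pow₀ (by norm_num)
        have hk : (0 : ℝ) < 2 ^ k := by positivity
        have hp : (2 : ℝ) ^ k ≤ 2 * 2 ^ (k - 1) := by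
          rw [← pow_succ']
          exact pow_le_pow_right₀ (by norm_num) (by omega)
        refine add_le_add ((tsum_aliasInd_level_le _ _ _).trans (ENNReal.ofReal_le_ofReal ?_))
          ((tsum_aliasInd_level_le _ _ _).trans (ENNReal.ofReal_le_ofReal ?_))
        · have : 2 * (2 : ℝ) ^ (k + i) / (2 * (2 ^ k : ℕ) + 1) ≤ 2 ^ i := by
            rw [div_le_iff₀ (by positivity), pow_add]
            push_cast
            nlinarith
          linarith
        · have : 2 * (2 : ℝ) ^ (k + i) / (2 * (2 ^ (k - 1) : ℕ) + 1) ≤ 2 * 2 ^ i := by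
            rw [div_le_iff₀ (by positivity), pow_add]
            push_cast
            nlinarith
          linarith
    _ = 5 * 2 ^ i := by
        rw [← ENNReal.ofReal_add (by positivity) (by positivity), ← add_mul,
          ENNReal.ofReal_mul (by norm_num), ENNReal.ofReal_pow (by norm_num)]
        norm_num

/-! ### Sums of extended nonnegative reals -/

lemma tsum_fin_cons {α : Type*} {d : ℕ} (F : (Fin (d + 1) → α) → ℝ≥0∞) :
    ∑' k, F k = ∑' (a : α) (k : Fin d → α), F (Fin.cons a k) := by
  rw [← (Fin.consEquiv fun _ : Fin (d + 1) => α).tsum_eq, ENNReal.tsum_prod']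
  rfl

lemma tsum_pi_prod {α : Type*} {d : ℕ} (g : Fin d → α → ℝ≥0∞) :
    ∑' k : Fin d → α, ∏ j, g j (k j) = ∏ j, ∑' a, g j a := by
  induction d with
  | zero => simp [tsum_fintype]
  | succ d ih =>
    rw [tsum_fin_cons, Fin.prod_univ_succ]
    simp only [Fin.prod_univ_succ, Fin.cons_zero, Fin.cons_succ, ENNReal.tsum_mul_left, ih,
      ENNReal.tsum_mul_right]

/-- The Cauchy–Schwarz inequality for series. -/
lemma tsum_mul_sq_le {ι : Type*} (f g : ι → ℝ≥0∞) :
    (∑' i, f i * g i) ^ 2 ≤ (∑' i, f i ^ 2) * ∑' i, g i ^ 2 := by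
  have h : ∑' i, f i * g i ≤ ((∑' i, f i ^ 2) * ∑' i, g i ^ 2) ^ (1 / 2 : ℝ) := by
    rw [ENNReal.tsum_eq_iSup_sum, ENNReal.mul_rpow_of_nonneg _ _ (by norm_num)]
    refine iSup_le fun s => (ENNReal.inner_le_Lp_mul_Lq s f g Real.HolderConjugate.two_two).trans ?_
    simp only [ENNReal.rpow_ofNat]
    gcongr <;> exact ENNReal.sum_le_tsum s
  calc _ ≤ (((∑' i, f i ^ 2) * ∑' i, g i ^ 2) ^ (1 / 2 : ℝ)) ^ 2 := by gcongr
    _ = _ := by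
      rw [← ENNReal.rpow_natCast, ← ENNReal.rpow_mul]
      norm_num

/-- Cauchy–Schwarz with respect to the weight `p`, written as the square of its square root; this is
the analytic core of the Schur test. -/
lemma tsum_mul_mul_sq_le {ι : Type*} (p x y : ι → ℝ≥0∞) :
    (∑' i, p i * (x i * y i)) ^ 2 ≤ (∑' i, p i * x i ^ 2) * ∑' i, p i * y i ^ 2 := by
  have h : ∀ i, (p i ^ (1 / 2 : ℝ)) * (p i ^ (1 / 2 : ℝ)) = p i := fun i => by
    rw [← ENNReal.rpow_add_of_nonneg _ _ (by norm_num) (by norm_num)]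
    norm_num
  have := tsum_mul_sq_le (fun i => p i ^ (1 / 2 : ℝ) * x i) fun i => p i ^ (1 / 2 : ℝ) * y i
  refine le_trans (le_of_eq ?_) (this.trans (le_of_eq ?_))
  · congr 2
    funext i
    rw [mul_mul_mul_comm, h]
  · simp only [mul_pow, sq (_ ^ (1 / 2 : ℝ)), h]

lemma tsum_pow_max_le (x : ℝ≥0∞) (m : ℕ) :
    ∑' j, x ^ max j m ≤ x ^ m * (m + (1 - x)⁻¹) := by
  rw [← ENNReal.summable.sum_add_tsum_nat_add' (k := m), mul_add]
  refine add_le_add (le_of_eq ?_) (le_of_eq ?_)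
  · rw [Finset.sum_congr rfl fun j hj => by rw [max_eq_right (Finset.mem_range.1 hj).le]]
    rw [Finset.sum_const, Finset.card_range, nsmul_eq_mul, mul_comm]
  · rw [← ENNReal.tsum_geometric, ← ENNReal.tsum_mul_left]
    refine tsum_congr fun j => ?_
    rw [max_eq_left (by omega), add_comm, pow_add]

lemma tsum_pow_tail (x : ℝ≥0∞) (m : ℕ) :
    ∑' j, (if m ≤ j then x ^ j else 0) = x ^ m * (1 - x)⁻¹ := by
  rw [← ENNReal.summable.sum_add_tsum_nat_add' (k := m), Finset.sum_eq_zero, zero_add]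
  · rw [← ENNReal.tsum_geometric, ← ENNReal.tsum_mul_left]
    refine tsum_congr fun j => ?_
    rw [if_pos (by omega), add_comm, pow_add]
  · intro j hj
    rw [if_neg (by simpa using hj)]

/-- Tails of the multivariate geometric series outside a simplex. -/
lemma exists_tsum_simplex_tail_le {x : ℝ≥0∞} (hx : x < 1) (d : ℕ) :
    ∃ C : ℝ≥0∞, C ≠ ∞ ∧ ∀ m : ℕ,
      ∑' k : Fin (d + 1) → ℕ, (if m ≤ ∑ j, k j then x ^ (∑ j, k j) else 0) ≤
        C * x ^ m * (m + 1) ^ d := by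
  have hG : (1 - x)⁻¹ ≠ ∞ := ENNReal.inv_ne_top.2 (tsub_pos_of_lt hx).ne'
  have hG1 : 1 ≤ (1 - x)⁻¹ := ENNReal.one_le_inv.2 tsub_le_self
  induction d with
  | zero =>
    refine ⟨(1 - x)⁻¹, hG, fun m => ?_⟩
    rw [tsum_fin_cons]
    simp only [tsum_fintype, Finset.univ_unique, Finset.sum_singleton, Fin.sum_univ_succ,
      Fin.cons_zero, Finset.univ_eq_empty, Finset.sum_empty, add_zero, tsum_pow_tail, pow_zero,
      mul_one]
    rw [mul_comm]
  | succ d ih =>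
    obtain ⟨C, hC, h⟩ := ih
    refine ⟨C * (1 - x)⁻¹, ENNReal.mul_ne_top hC hG, fun m => ?_⟩
    rw [tsum_fin_cons]
    -- Once the first coordinate is `j`, the others must sum to at least the truncated difference `m
    -- - j`, and `x^j · x^(m-j) = x^(max j m)`. Summing over `j` then costs one more power of `m +
    -- 1`, from the `m` equal terms with `j < m`.
    calc _ ≤ ∑' j, C * (m + 1) ^ d * x ^ max j m := ENNReal.tsum_le_tsum fun j => ?_
      _ ≤ C * (m + 1) ^ d * (x ^ m * (m + (1 - x)⁻¹)) := by
        rw [ENNReal.tsum_mul_left]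
        gcongr
        exact tsum_pow_max_le x m
      _ ≤ C * (m + 1) ^ d * (x ^ m * ((1 - x)⁻¹ * (m + 1))) := by
        gcongr
        rw [mul_add, mul_one]
        gcongr
        exact le_mul_of_one_le_left' hG1
      _ = _ := by ring
    calc _ = x ^ j * ∑' k : Fin (d + 1) → ℕ,
          (if m - j ≤ ∑ i, k i then x ^ (∑ i, k i) else 0) := by
          rw [← ENNReal.tsum_mul_left]
          refine tsum_congr fun k => ?_
          rw [Fin.sum_univ_succ]
          simp only [Fin.cons_zero, Fin.cons_succ, tsub_le_iff_left, mul_ite, mul_zero, pow_add]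
      _ ≤ x ^ j * (C * x ^ (m - j) * ((m - j : ℕ) + 1) ^ d) := by
          gcongr
          exact h _
      _ ≤ x ^ j * (C * x ^ (m - j) * (m + 1) ^ d) := by
          gcongr
          omega
      _ = _ := by
          rw [show max j m = j + (m - j) by omega, pow_add]
          ring

lemma two_rpow_add (a b : ℝ) : (2 : ℝ≥0∞) ^ (a + b) = 2 ^ a * 2 ^ b :=
  ENNReal.rpow_add a b two_ne_zero ENNReal.ofNat_ne_top

lemma two_rpow_sum {ι : Type*} (s : Finset ι) (a : ι → ℝ) :
    (2 : ℝ≥0∞) ^ (∑ i ∈ s, a i) = ∏ i ∈ s, 2 ^ a i := by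
  classical
  induction s using Finset.induction_on with
  | empty => simp
  | insert i s hi ih => rw [Finset.sum_insert hi, Finset.prod_insert hi, two_rpow_add, ih]

lemma two_rpow_sq (a : ℝ) : ((2 : ℝ≥0∞) ^ a) ^ 2 = 2 ^ (2 * a) := by
  rw [← ENNReal.rpow_natCast, ← ENNReal.rpow_mul]
  congr 1
  push_cast
  ring

lemma tsum_two_rpow_ne_top {r : ℝ} (hr : 0 < r) : ∑' i : ℕ, (2 : ℝ≥0∞) ^ (-(r * i)) ≠ ∞ := by
  have h : ∀ i : ℕ, (2 : ℝ≥0∞) ^ (-(r * i)) = (2 ^ (-r)) ^ i := fun i => by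
    rw [← ENNReal.rpow_natCast, ← ENNReal.rpow_mul, neg_mul]
  simp only [h, ENNReal.tsum_geometric]
  exact ENNReal.inv_ne_top.2 (tsub_pos_of_lt
    (ENNReal.rpow_lt_one_of_one_lt_of_neg (by norm_num) (by linarith))).ne'

/-! ### Schur estimates for the aliasing kernel -/

/-- At level `k + i` the aliasing mass is at most `5·2^i`, so the decay `2^(-si)` is summable
exactly when `s > 1`. -/
lemma exists_tsum_etaAbs_source_le {s : ℝ} (hs : 1 < s) :
    ∃ C : ℝ≥0∞, C ≠ ∞ ∧ ∀ (k : ℕ) (n : ℤ),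
      ∑' l, etaAbs k l n * 2 ^ (-(s * ((level l : ℝ) - k))) ≤ C := by
  refine ⟨5 * ∑' i : ℕ, (2 : ℝ≥0∞) ^ (-((s - 1) * i)),
    ENNReal.mul_ne_top (by simp) (tsum_two_rpow_ne_top (by linarith)), fun k n => ?_⟩
  calc _ ≤ ∑' l, ∑' i : ℕ, (if level l = k + i then etaAbs k l n else 0) * 2 ^ (-(s * i)) := by
        refine ENNReal.tsum_le_tsum fun l => ?_
        rcases lt_or_ge (level l) k with h | h
        · rw [etaAbs_eq_zero_of_level_lt h, zero_mul]
          exact zero_le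
        · refine le_trans (le_of_eq ?_) (ENNReal.le_tsum (level l - k))
          rw [if_pos (by omega), Nat.cast_sub h]
    _ = ∑' i : ℕ, (∑' l, if level l = k + i then etaAbs k l n else 0) * 2 ^ (-(s * i)) := by
        rw [ENNReal.tsum_comm]
        simp only [ENNReal.tsum_mul_right]
    _ ≤ ∑' i : ℕ, 5 * 2 ^ (-((s - 1) * i)) := by
        refine ENNReal.tsum_le_tsum fun i => ?_
        calc _ ≤ 5 * 2 ^ i * (2 : ℝ≥0∞) ^ (-(s * i)) := by
              gcongr
              exact tsum_etaAbs_level_le k i n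
          _ = _ := by
              rw [mul_assoc, ← ENNReal.rpow_natCast, ← two_rpow_add]
              congr 2
              ring
    _ = _ := ENNReal.tsum_mul_left

/-- Each `k` contributes at most two targets and only `k ≤ level l` matter, so any positive rate `r`
gives a geometric series in `level l - k`. -/
lemma exists_tsum_etaAbs_target_le {r : ℝ} (hr : 0 < r) :
    ∃ C : ℝ≥0∞, C ≠ ∞ ∧ ∀ l : ℤ,
      ∑' k : ℕ, ∑' n, etaAbs k l n * 2 ^ (-(r * ((level l : ℝ) - k))) ≤ C := by
  refine ⟨2 * ∑' i : ℕ, (2 : ℝ≥0∞) ^ (-(r * i)),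
    ENNReal.mul_ne_top (by simp) (tsum_two_rpow_ne_top hr), fun l => ?_⟩
  calc _ ≤ ∑' k : ℕ, ∑' i : ℕ, (if k + i = level l then 2 * 2 ^ (-(r * i)) else (0 : ℝ≥0∞)) := by
        refine ENNReal.tsum_le_tsum fun k => ?_
        rw [ENNReal.tsum_mul_right]
        rcases lt_or_ge (level l) k with h | h
        · simp [etaAbs_eq_zero_of_level_lt h]
        · refine le_trans ?_ (ENNReal.le_tsum (level l - k))
          rw [if_pos (by omega), Nat.cast_sub h]
          gcongr
          exact tsum_etaAbs_le k l
    _ = ∑' i : ℕ, ∑' k : ℕ, (if k + i = level l then 2 * 2 ^ (-(r * i)) else (0 : ℝ≥0∞)) :=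
        ENNReal.tsum_comm
    _ ≤ ∑' i : ℕ, 2 * 2 ^ (-(r * i)) := by
        refine ENNReal.tsum_le_tsum fun i => ?_
        rw [tsum_eq_single (level l - i)]
        · split_ifs
          · exact le_rfl
          · exact zero_le
        · intro k hk
          rw [if_neg (by omega)]
    _ = _ := ENNReal.tsum_mul_left

/-- Indicator of the complement of the Smolyak index set. -/
def tailInd {d : ℕ} (m : ℕ) (k : Fin d → ℕ) : ℝ≥0∞ := if m < ∑ j, k j then 1 else 0

/-- Weighted Schur test for the error kernel of the Smolyak operator. -/
lemma exists_tsum_error_kernel_le {α : ℝ} (hα : 1 / 2 < α) (d : ℕ) :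
    ∃ C : ℝ≥0∞, C ≠ ∞ ∧ ∀ (b : (Fin d → ℤ) → ℝ≥0∞) (m : ℕ),
      ∑' n : Fin d → ℤ, (∑' (l : Fin d → ℤ) (k : Fin d → ℕ),
        tailInd m k * (∏ j, etaAbs (k j) (l j) (n j)) *
          (b l * ∏ j, 2 ^ (-(α * level (l j))))) ^ 2 ≤
      C * (∑' k : Fin d → ℕ, tailInd m k * ∏ j, 2 ^ (-(2 * α * k j))) * ∑' l, b l ^ 2 := by
  -- The Schur bounds need `s > 1`, `r > 0` and `s + r = 2α`; this choice gives `r = α - 1/2`, so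
  -- both hold exactly when `α > 1/2`.
  set s : ℝ := α + 1 / 2 with hs
  set r : ℝ := 2 * α - s with hr
  obtain ⟨C₁, hC₁, h₁⟩ := exists_tsum_etaAbs_source_le (s := s) (by linarith)
  obtain ⟨C₂, hC₂, h₂⟩ := exists_tsum_etaAbs_target_le (r := r) (by linarith)
  refine ⟨C₁ ^ d * C₂ ^ d, ENNReal.mul_ne_top (ENNReal.pow_ne_top hC₁) (ENNReal.pow_ne_top hC₂),
    fun b m => ?_⟩
  set S := ∑' k : Fin d → ℕ, tailInd m k * ∏ j, (2 : ℝ≥0∞) ^ (-(2 * α * k j)) with hS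
  let p : (Fin d → ℤ) → (Fin d → ℤ) × (Fin d → ℕ) → ℝ≥0∞ := fun n i =>
    tailInd m i.2 * ∏ j, etaAbs (i.2 j) (i.1 j) (n j)
  let x : (Fin d → ℤ) × (Fin d → ℕ) → ℝ≥0∞ := fun i =>
    ∏ j, 2 ^ (-(α * i.2 j) - s / 2 * ((level (i.1 j) : ℝ) - i.2 j))
  let y : (Fin d → ℤ) × (Fin d → ℕ) → ℝ≥0∞ := fun i =>
    b i.1 * ∏ j, 2 ^ (-(r / 2 * ((level (i.1 j) : ℝ) - i.2 j)))
  -- Per coordinate, `α·level l = α·k + (s/2 + r/2)·(level l - k)`; the `k`-part goes entirely into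
  -- `x`.
  have hxy : ∀ i, b i.1 * ∏ j, (2 : ℝ≥0∞) ^ (-(α * level (i.1 j))) = x i * y i := fun i => by
    simp only [x, y]
    rw [mul_left_comm, ← Finset.prod_mul_distrib]
    congr 1
    refine Finset.prod_congr rfl fun j _ => ?_
    rw [← two_rpow_add]
    congr 1
    rw [hr]
    ring
  have hx : ∀ n, ∑' i, p n i * x i ^ 2 ≤ C₁ ^ d * S := fun n => by
    calc _ = ∑' k : Fin d → ℕ, (tailInd m k * ∏ j, (2 : ℝ≥0∞) ^ (-(2 * α * k j))) *
          ∑' l : Fin d → ℤ, ∏ j,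
            etaAbs (k j) (l j) (n j) * 2 ^ (-(s * ((level (l j) : ℝ) - k j))) := by
          rw [ENNReal.tsum_prod', ENNReal.tsum_comm]
          refine tsum_congr fun k => ?_
          rw [← ENNReal.tsum_mul_left]
          refine tsum_congr fun l => ?_
          simp only [p, x]
          rw [← Finset.prod_pow, mul_assoc, mul_assoc, ← Finset.prod_mul_distrib,
            ← Finset.prod_mul_distrib]
          congr 1
          refine Finset.prod_congr rfl fun j _ => ?_
          rw [mul_left_comm, two_rpow_sq, ← two_rpow_add]
          congr 2
          ring
      _ ≤ ∑' k : Fin d → ℕ, (tailInd m k * ∏ j, (2 : ℝ≥0∞) ^ (-(2 * α * k j))) * C₁ ^ d := by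
          refine ENNReal.tsum_le_tsum fun k => mul_le_mul_right ?_ _
          rw [tsum_pi_prod fun j a =>
            etaAbs (k j) a (n j) * 2 ^ (-(s * ((level a : ℝ) - k j)))]
          refine (Finset.prod_le_prod' fun j _ => h₁ (k j) (n j)).trans ?_
          simp
      _ = _ := by rw [ENNReal.tsum_mul_right, mul_comm]
  have hy : ∑' n, ∑' i, p n i * y i ^ 2 ≤ C₂ ^ d * ∑' l, b l ^ 2 := by
    calc _ ≤ ∑' l, b l ^ 2 * ∑' (k : Fin d → ℕ) (n : Fin d → ℤ), ∏ j,
            etaAbs (k j) (l j) (n j) * 2 ^ (-(r * ((level (l j) : ℝ) - k j))) := by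
          rw [ENNReal.tsum_comm, ENNReal.tsum_prod']
          refine ENNReal.tsum_le_tsum fun l => ?_
          simp only [← ENNReal.tsum_mul_left]
          refine ENNReal.tsum_le_tsum fun k => ENNReal.tsum_le_tsum fun n => ?_
          simp only [p, y]
          rw [mul_pow, ← Finset.prod_pow, Finset.prod_mul_distrib]
          -- The restriction `|k|_1 > m` was spent on the `x`-factor, where it produces `S`; here it
          -- can be dropped.
          have ht : tailInd m k ≤ 1 := by
            unfold tailInd
            split_ifs <;> simp
          have he : ∀ j, ((2 : ℝ≥0∞) ^ (-(r / 2 * ((level (l j) : ℝ) - k j)))) ^ 2 =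
              2 ^ (-(r * ((level (l j) : ℝ) - k j))) := fun j => by
            rw [two_rpow_sq]
            congr 1
            ring
          simp only [he]
          calc _ ≤ 1 * (∏ j, etaAbs (k j) (l j) (n j)) *
                (b l ^ 2 * ∏ j, 2 ^ (-(r * ((level (l j) : ℝ) - k j)))) := by gcongr
            _ = _ := by ring
      _ ≤ ∑' l, b l ^ 2 * C₂ ^ d := by
          refine ENNReal.tsum_le_tsum fun l => mul_le_mul_right ?_ _
          have he : ∀ k : Fin d → ℕ, ∑' n : Fin d → ℤ, ∏ j, etaAbs (k j) (l j) (n j) *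
              (2 : ℝ≥0∞) ^ (-(r * ((level (l j) : ℝ) - k j))) = _ := fun k =>
            tsum_pi_prod fun j a => etaAbs (k j) (l j) a * 2 ^ (-(r * ((level (l j) : ℝ) - k j)))
          simp only [he]
          rw [tsum_pi_prod fun j k =>
            ∑' a, etaAbs k (l j) a * (2 : ℝ≥0∞) ^ (-(r * ((level (l j) : ℝ) - k)))]
          refine (Finset.prod_le_prod' fun j _ => h₂ (l j)).trans ?_
          simp
      _ = _ := by rw [ENNReal.tsum_mul_right, mul_comm]
  calc _ = ∑' n, (∑' i, p n i * (x i * y i)) ^ 2 := by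
        refine tsum_congr fun n => ?_
        rw [ENNReal.tsum_prod']
        simp only [← hxy]
        rfl
    _ ≤ ∑' n, C₁ ^ d * S * ∑' i, p n i * y i ^ 2 := by
        refine ENNReal.tsum_le_tsum fun n => (tsum_mul_mul_sq_le _ x y).trans ?_
        gcongr
        exact hx n
    _ ≤ C₁ ^ d * S * (C₂ ^ d * ∑' l, b l ^ 2) := by
        rw [ENNReal.tsum_mul_left]
        gcongr
    _ = _ := by ring

lemma tsum_two_rpow_level_ne_top {r : ℝ} (hr : 1 < r) :
    ∑' l : ℤ, (2 : ℝ≥0∞) ^ (-(r * level l)) ≠ ∞ := by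
  refine ne_top_of_le_ne_top (ENNReal.mul_ne_top (by simp)
    (tsum_two_rpow_ne_top (r := r - 1) (by linarith)) : 3 * _ ≠ ∞) ?_
  -- For `m = 0` the modulus is `1` and every frequency is aliased to `0`, so the aliasing count
  -- becomes the count of integers of a given level.
  calc _ ≤ ∑' l : ℤ, ∑' i : ℕ, (if level l = i then aliasInd 0 l 0 else 0) *
        (2 : ℝ≥0∞) ^ (-(r * i)) := by
        refine ENNReal.tsum_le_tsum fun l => le_trans (le_of_eq ?_) (ENNReal.le_tsum (level l))
        simp [aliasInd]
    _ = ∑' i : ℕ, (∑' l, if level l = i then aliasInd 0 l 0 else 0) * 2 ^ (-(r * i)) := by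
        rw [ENNReal.tsum_comm]
        simp only [ENNReal.tsum_mul_right]
    _ ≤ ∑' i : ℕ, 3 * 2 ^ (-((r - 1) * i)) := by
        refine ENNReal.tsum_le_tsum fun i => ?_
        calc _ ≤ 3 * 2 ^ i * (2 : ℝ≥0∞) ^ (-(r * i)) := by
              gcongr
              refine (tsum_aliasInd_level_le 0 i 0).trans ?_
              rw [← ENNReal.ofReal_ofNat, ← ENNReal.ofReal_ofNat 2, ← ENNReal.ofReal_pow (by simp),
                ← ENNReal.ofReal_mul (by simp)]
              refine ENNReal.ofReal_le_ofReal ?_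
              have hi : (1 : ℝ) ≤ 2 ^ i := one_le_pow₀ (by norm_num)
              norm_num
              linarith
          _ = _ := by
              rw [mul_assoc, ← ENNReal.rpow_natCast, ← two_rpow_add]
              congr 2
              ring
    _ = _ := ENNReal.tsum_mul_left

/-! ### The norms in terms of Fourier coefficients -/

/-- The index of the product of dyadic blocks containing `l`. -/
def levels (l : Fin d → ℤ) : Fin d → ℕ := fun j => level (l j)

lemma mem_piFinset_dyadicBlock {k : Fin d → ℕ} {l : Fin d → ℤ} :
    l ∈ Fintype.piFinset (fun j => dyadicBlock (k j)) ↔ levels l = k := by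
  simp [mem_dyadicBlock, levels, funext_iff]

/-- The square root of the dyadic weight of the hybrid norm. -/
def hybridWeight (α β : ℝ) (l : Fin d → ℤ) : ℝ≥0∞ :=
  2 ^ (α * (oneNorm (levels l) : ℝ) + β * (supNorm (levels l) : ℝ))

lemma ofReal_norm_sq (z : ℂ) : ENNReal.ofReal (‖z‖ ^ 2) = ‖z‖ₑ ^ 2 := by
  rw [ENNReal.ofReal_pow (norm_nonneg _), ofReal_norm]

lemma ofReal_two_rpow (a : ℝ) : ENNReal.ofReal ((2 : ℝ) ^ a) = 2 ^ a := by
  rw [← ENNReal.ofReal_rpow_of_pos two_pos, ENNReal.ofReal_ofNat]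

/-- Orthogonality within each block, and each frequency lies in exactly one block. -/
lemma hybridNorm_eq (α β : ℝ) (f : Torus d → ℂ) :
    hybridNorm α β f = (ENNReal.ofReal ((2 * π) ^ d) *
      ∑' l, (hybridWeight α β l * ‖coeff f l‖ₑ) ^ 2) ^ (1 / 2 : ℝ) := by
  have h : ∀ k : Fin d → ℕ,
      ENNReal.ofReal ((2 : ℝ) ^ (2 * (α * (oneNorm k : ℝ) + β * (supNorm k : ℝ)))) *
        eLpNorm (dyadicPart k f) 2 volume ^ 2 = ENNReal.ofReal ((2 * π) ^ d) *
      ∑' l, if k = levels l then (hybridWeight α β l * ‖coeff f l‖ₑ) ^ 2 else 0 := fun k => by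
    have h1 : dyadicPart k f = fun x =>
        ∑ l ∈ Fintype.piFinset (fun j => dyadicBlock (k j)), coeff f l * expo l x := rfl
    rw [h1, eLpNorm_sum_expo_sq, mul_left_comm]
    congr 1
    rw [tsum_eq_sum (s := Fintype.piFinset fun j => dyadicBlock (k j)), Finset.mul_sum]
    · refine Finset.sum_congr rfl fun l hl => ?_
      rw [mem_piFinset_dyadicBlock] at hl
      rw [if_pos hl.symm, mul_pow, hybridWeight, two_rpow_sq, hl, ofReal_norm_sq, ofReal_two_rpow]
    · intro l hl
      rw [mem_piFinset_dyadicBlock] at hl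
      exact if_neg (Ne.symm hl)
  rw [hybridNorm]
  simp only [h, ENNReal.tsum_mul_left]
  rw [ENNReal.tsum_comm]
  simp only [tsum_ite_eq]

lemma level_pow_le (n : ℤ) : (4 : ℝ) ^ level n ≤ 4 * (1 + (n : ℝ) ^ 2) := by
  rcases Nat.eq_zero_or_pos (level n) with h | h
  · rw [h]
    nlinarith [sq_nonneg (n : ℝ)]
  · have h1 : (2 : ℤ) ^ (level n - 1) ≤ |n| := lt_level_iff.1 (by omega)
    have h2 : (2 : ℝ) ^ (level n - 1) ≤ |(n : ℝ)| := by exact_mod_cast h1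
    have h3 : ((2 : ℝ) ^ (level n - 1)) ^ 2 ≤ (n : ℝ) ^ 2 := by
      rw [← sq_abs (n : ℝ)]
      gcongr
    have h4 : (4 : ℝ) ^ level n = 4 * ((2 : ℝ) ^ (level n - 1)) ^ 2 := by
      rw [← pow_mul, mul_comm (level n - 1), pow_mul, show (2 : ℝ) ^ 2 = 4 by norm_num, ← pow_succ']
      congr 1
      omega
    linarith

lemma supNorm_levels_pow_le (l : Fin d → ℤ) :
    (4 : ℝ) ^ supNorm (levels l) ≤ 4 * (1 + ∑ j, (l j : ℝ) ^ 2) := by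
  have hs : 0 ≤ ∑ j, (l j : ℝ) ^ 2 := Finset.sum_nonneg fun _ _ => sq_nonneg _
  refine Finset.sup_induction (p := fun a : ℕ => (4 : ℝ) ^ a ≤ 4 * (1 + ∑ j, (l j : ℝ) ^ 2))
    ?_ ?_ ?_
  · rw [Nat.bot_eq_zero, pow_zero]
    linarith
  · intro a ha b hb
    rcases le_total a b with h | h
    · rwa [sup_eq_right.2 h]
    · rwa [sup_eq_left.2 h]
  · intro j _
    have := Finset.single_le_sum (f := fun j => (l j : ℝ) ^ 2) (fun _ _ => sq_nonneg _)
      (Finset.mem_univ j)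
    exact (level_pow_le (l j)).trans (by linarith)

lemma sq_le_level_pow (n : ℤ) : (n : ℝ) ^ 2 ≤ 4 ^ level n := by
  have h1 : |n| ≤ 2 ^ level n := (level_le_iff.1 le_rfl).le
  have h2 : |(n : ℝ)| ≤ 2 ^ level n := by exact_mod_cast h1
  calc (n : ℝ) ^ 2 = |(n : ℝ)| ^ 2 := (sq_abs _).symm
    _ ≤ (2 ^ level n) ^ 2 := by gcongr
    _ = 4 ^ level n := by rw [← pow_mul, mul_comm, pow_mul]; norm_num

/-- Membership in the spaces uses the non-dyadic weights, the estimates use the dyadic ones. This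
direction serves the hypothesis on `f`; the converse, `sharp_weight_le`, is needed only with `α =
0`, for the error. -/
lemma hybridWeight_sq_le {α β : ℝ} (hα : 0 ≤ α) (hβ : 0 ≤ β) (l : Fin d → ℤ) :
    hybridWeight α β l ^ 2 ≤ ENNReal.ofReal (((4 : ℝ) ^ α) ^ d * 4 ^ β) *
      ENNReal.ofReal ((∏ j, (1 + (l j : ℝ) ^ 2) ^ α) * (1 + ∑ j, (l j : ℝ) ^ 2) ^ β) := by
  have e1 : ∀ (a : ℝ) (N : ℕ), (2 : ℝ) ^ (2 * (a * N)) = ((4 : ℝ) ^ N) ^ a := fun a N => by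
    rw [← Real.rpow_natCast, ← Real.rpow_mul (by norm_num), Real.rpow_mul (by norm_num)]
    norm_num [mul_comm]
  rw [hybridWeight, two_rpow_sq, ← ofReal_two_rpow, ← ENNReal.ofReal_mul (by positivity)]
  refine ENNReal.ofReal_le_ofReal ?_
  rw [mul_add, Real.rpow_add two_pos, e1, e1]
  have h1 : ((4 : ℝ) ^ oneNorm (levels l)) ^ α ≤
      ((4 : ℝ) ^ α) ^ d * ∏ j, (1 + (l j : ℝ) ^ 2) ^ α := by
    rw [oneNorm, ← Finset.prod_pow_eq_pow_sum, ← Real.finsetProd_rpow _ _ fun _ _ => by positivity]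
    calc _ ≤ ∏ j, ((4 : ℝ) ^ α * (1 + (l j : ℝ) ^ 2) ^ α) := by
          refine Finset.prod_le_prod (fun _ _ => by positivity) fun j _ => ?_
          rw [← Real.mul_rpow (by norm_num) (by positivity)]
          exact Real.rpow_le_rpow (by positivity) (level_pow_le (l j)) hα
      _ = _ := by rw [Finset.prod_mul_distrib]; simp
  have h2 : ((4 : ℝ) ^ supNorm (levels l)) ^ β ≤ 4 ^ β * (1 + ∑ j, (l j : ℝ) ^ 2) ^ β := by
    rw [← Real.mul_rpow (by norm_num) (by positivity)]
    exact Real.rpow_le_rpow (by positivity) (supNorm_levels_pow_le l) hβ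
  calc _ ≤ (((4 : ℝ) ^ α) ^ d * ∏ j, (1 + (l j : ℝ) ^ 2) ^ α) *
        (4 ^ β * (1 + ∑ j, (l j : ℝ) ^ 2) ^ β) := by gcongr
    _ = _ := by ring

lemma sharp_weight_le {β : ℝ} (hβ : 0 ≤ β) (l : Fin d → ℤ) :
    ENNReal.ofReal ((∏ j, (1 + (l j : ℝ) ^ 2) ^ (0 : ℝ)) * (1 + ∑ j, (l j : ℝ) ^ 2) ^ β) ≤
      ENNReal.ofReal ((1 + d : ℝ) ^ β) * hybridWeight 0 β l ^ 2 := by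
  have e1 : (2 : ℝ) ^ (2 * (β * supNorm (levels l))) = ((4 : ℝ) ^ supNorm (levels l)) ^ β := by
    rw [← Real.rpow_natCast, ← Real.rpow_mul (by norm_num), Real.rpow_mul (by norm_num)]
    norm_num [mul_comm]
  rw [hybridWeight, two_rpow_sq, ← ofReal_two_rpow, ← ENNReal.ofReal_mul (by positivity)]
  refine ENNReal.ofReal_le_ofReal ?_
  simp only [Real.rpow_zero, Finset.prod_const_one, one_mul, zero_mul, zero_add]
  rw [e1, ← Real.mul_rpow (by positivity) (by positivity)]
  refine Real.rpow_le_rpow (by positivity) ?_ hβ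
  have h1 : ∀ j, (l j : ℝ) ^ 2 ≤ 4 ^ supNorm (levels l) := fun j =>
    (sq_le_level_pow (l j)).trans (pow_le_pow_right₀ (by norm_num)
      (Finset.le_sup (f := levels l) (Finset.mem_univ j)))
  have h2 : ∑ j, (l j : ℝ) ^ 2 ≤ d * 4 ^ supNorm (levels l) :=
    (Finset.sum_le_sum fun j _ => h1 j).trans (by simp)
  have h3 : (1 : ℝ) ≤ 4 ^ supNorm (levels l) := one_le_pow₀ (by norm_num)
  linarith

lemma rpow_half_lt_top_iff {x : ℝ≥0∞} : x ^ (1 / 2 : ℝ) < ∞ ↔ x < ∞ :=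
  ENNReal.rpow_lt_top_iff_of_pos (by norm_num)

lemma tsum_hybridWeight_lt_top {α β : ℝ} (hα : 0 ≤ α) (hβ : 0 ≤ β) {f : Torus d → ℂ}
    (hf : sharpNorm α β f < ∞) : ∑' l, (hybridWeight α β l * ‖coeff f l‖ₑ) ^ 2 < ∞ := by
  rw [sharpNorm, rpow_half_lt_top_iff] at hf
  refine lt_of_le_of_lt ?_ (ENNReal.mul_lt_top
    (ENNReal.ofReal_lt_top (r := ((4 : ℝ) ^ α) ^ d * 4 ^ β)) hf)
  rw [← ENNReal.tsum_mul_left]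
  refine ENNReal.tsum_le_tsum fun l => ?_
  rw [mul_pow, ENNReal.ofReal_mul (p := ‖coeff f l‖ ^ 2) (by positivity), ofReal_norm_sq,
    mul_left_comm, mul_comm]
  exact mul_le_mul_right (hybridWeight_sq_le hα hβ l) _

lemma sharpNorm_lt_top_of_tsum {β : ℝ} (hβ : 0 ≤ β) {f : Torus d → ℂ}
    (hf : ∑' l, (hybridWeight 0 β l * ‖coeff f l‖ₑ) ^ 2 < ∞) : sharpNorm 0 β f < ∞ := by
  rw [sharpNorm, rpow_half_lt_top_iff]
  refine lt_of_le_of_lt ?_ (ENNReal.mul_lt_top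
    (ENNReal.ofReal_lt_top (r := (1 + d : ℝ) ^ β)) hf)
  rw [← ENNReal.tsum_mul_left]
  refine ENNReal.tsum_le_tsum fun l => ?_
  rw [mul_pow, ENNReal.ofReal_mul (p := ‖coeff f l‖ ^ 2) (by positivity), ofReal_norm_sq,
    ← mul_assoc, mul_comm]
  exact mul_le_mul_left (sharp_weight_le hβ l) _

lemma hybridWeight_mul_prod (α β : ℝ) (l : Fin d → ℤ) :
    hybridWeight α β l * ∏ j, 2 ^ (-(α * level (l j))) =
      2 ^ (β * (supNorm (levels l) : ℝ)) := by
  rw [hybridWeight, ← two_rpow_sum, ← two_rpow_add]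
  congr 1
  rw [oneNorm, Finset.sum_neg_distrib, ← Finset.mul_sum]
  push_cast
  simp only [levels]
  ring

lemma summable_coeff_of_tsum {α β : ℝ} (hα : 1 / 2 < α) (hβ : 0 ≤ β) {f : Torus d → ℂ}
    (hf : ∑' l, (hybridWeight α β l * ‖coeff f l‖ₑ) ^ 2 < ∞) :
    Summable fun l => ‖coeff f l‖ := by
  have h : ∑' l, ‖coeff f l‖ₑ ≠ ∞ := by
    -- The `β`-part of the weight is at least `1` and is discarded; Cauchy–Schwarz then needs `∑
    -- 2^(-2α·level)` finite, that is, `2α > 1`.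
    have h1 : ∀ l : Fin d → ℤ, ‖coeff f l‖ₑ ≤
        (hybridWeight α β l * ‖coeff f l‖ₑ) * ∏ j, 2 ^ (-(α * level (l j))) := fun l => by
      rw [mul_right_comm, hybridWeight_mul_prod]
      refine le_mul_of_one_le_left' ?_
      rw [← ENNReal.rpow_zero (x := 2)]
      exact ENNReal.rpow_le_rpow_of_exponent_le (by norm_num) (by positivity)
    refine ne_top_of_le_ne_top ?_ (ENNReal.tsum_le_tsum h1)
    have h2 := tsum_mul_sq_le (fun l => hybridWeight α β l * ‖coeff f l‖ₑ)
      fun l : Fin d → ℤ => ∏ j, (2 : ℝ≥0∞) ^ (-(α * level (l j)))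
    have h3 : ∑' l : Fin d → ℤ, (∏ j, (2 : ℝ≥0∞) ^ (-(α * level (l j)))) ^ 2 ≠ ∞ := by
      simp only [← Finset.prod_pow, two_rpow_sq]
      rw [tsum_pi_prod fun _ (a : ℤ) => (2 : ℝ≥0∞) ^ (2 * -(α * level a))]
      refine ENNReal.prod_ne_top fun j _ => ?_
      convert tsum_two_rpow_level_ne_top (r := 2 * α) (by linarith) using 4
      ring
    intro h4
    rw [h4] at h2
    refine ENNReal.mul_ne_top hf.ne h3 (top_unique ?_)
    simpa using h2
  simpa only [enorm_eq_nnnorm, ENNReal.tsum_coe_ne_top_iff_summable, ← NNReal.summable_coe,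
    coe_nnnorm] using h

/-! ### The error of the Smolyak operator -/

lemma mem_smolyakIndex {m : ℕ} {k : Fin d → ℕ} : k ∈ smolyakIndex d m ↔ ∑ j, k j ≤ m := by
  rw [smolyakIndex, Finset.mem_filter, Fintype.mem_piFinset, oneNorm]
  refine ⟨fun h => h.2, fun h => ⟨fun j => ?_, h⟩⟩
  have := Finset.single_le_sum (f := k) (fun _ _ => Nat.zero_le _) (Finset.mem_univ j)
  exact Finset.mem_range.2 (by omega)

/-- The multivariate coefficients telescope, leaving the terms outside the simplex. -/
lemma enorm_sub_sum_smolyak_le (m : ℕ) (l n : Fin d → ℤ) :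
    ‖(if l = n then 1 else 0 : ℂ) -
        ∑ k ∈ smolyakIndex d m, ∏ j, (etaCoeff (k j) (l j) (n j) : ℂ)‖ₑ ≤
      ∑' k : Fin d → ℕ, tailInd m k * ∏ j, etaAbs (k j) (l j) (n j) := by
  -- The box must contain the simplex and also reach every `level (l j)`, so that each univariate
  -- sum has telescoped completely.
  set M := max m (supNorm (levels l)) with hM
  set box := Fintype.piFinset fun _ : Fin d => Finset.range (M + 1) with hbox
  have hlev : ∀ j, level (l j) ≤ M := fun j =>
    (Finset.le_sup (f := levels l) (Finset.mem_univ j)).trans (le_max_right _ _)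
  have h1 : (if l = n then 1 else 0 : ℂ) =
      ∑ k ∈ box, ∏ j, (etaCoeff (k j) (l j) (n j) : ℂ) := by
    rw [hbox, ← Finset.prod_univ_sum (fun _ => Finset.range (M + 1))
      fun j k => (etaCoeff k (l j) (n j) : ℂ)]
    have : ∀ j, ∑ k ∈ Finset.range (M + 1), (etaCoeff k (l j) (n j) : ℂ) =
        if l j = n j then 1 else 0 := fun j => by
      rw [← Int.cast_sum, sum_etaCoeff_of_level_le (hlev j)]
      push_cast
      rfl
    simp only [this, Finset.prod_ite_zero, Finset.prod_const_one, Finset.mem_univ,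
      true_implies, funext_iff]
  have h2 : smolyakIndex d m ⊆ box := fun k hk => by
    rw [mem_smolyakIndex] at hk
    refine Fintype.mem_piFinset.2 fun j => Finset.mem_range.2 ?_
    have := Finset.single_le_sum (f := k) (fun _ _ => Nat.zero_le _) (Finset.mem_univ j)
    omega
  rw [h1, ← Finset.sum_sdiff h2, add_sub_cancel_right]
  refine (enorm_sum_le _ _).trans ((Finset.sum_le_sum fun k hk => ?_).trans
    (ENNReal.sum_le_tsum (box \ smolyakIndex d m)))
  rw [Finset.mem_sdiff, mem_smolyakIndex, not_le] at hk
  rw [tailInd, if_pos hk.2, one_mul, enorm_eq_nnnorm, nnnorm_prod]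
  push_cast
  refine Finset.prod_le_prod' fun j _ => le_of_eq ?_
  rw [etaAbs, enorm_eq_nnnorm]
  congr 1
  ext
  simp [Int.norm_eq_abs]

variable {f : Torus d → ℂ} {g : Torus d → ℂ}

lemma continuous_samplingOp (hc : Summable fun l => ‖coeff f l‖)
    (hg : ∀ x, g x = ∑' l, coeff f l * expo l x) (Δ : Finset (Fin d → ℕ)) :
    Continuous (samplingOp Δ g) :=
  continuous_finsetSum _ fun k _ => continuous_q_of_tsum hc hg k

/-- The coefficients of `f` and of the sampled `g` are both series in `coeff f l`, so the error is
the matrix identity minus the Smolyak matrix applied to `coeff f`. -/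
lemma enorm_coeff_error_le (hf : MemLp f 2) (hc : Summable fun l => ‖coeff f l‖)
    (hg : ∀ x, g x = ∑' l, coeff f l * expo l x) (m : ℕ) (n : Fin d → ℤ) :
    ‖coeff (fun x => f x - samplingOp (smolyakIndex d m) g x) n‖ₑ ≤
      ∑' (l : Fin d → ℤ) (k : Fin d → ℕ),
        tailInd m k * (∏ j, etaAbs (k j) (l j) (n j)) * ‖coeff f l‖ₑ := by
  have hs : HasSum (fun l => coeff f l * ((if l = n then 1 else 0 : ℂ) -
      ∑ k ∈ smolyakIndex d m, ∏ j, (etaCoeff (k j) (l j) (n j) : ℂ)))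
      (coeff (fun x => f x - samplingOp (smolyakIndex d m) g x) n) := by
    rw [coeff_sub (hf.integrable (by norm_num))
      (integrable_of_continuous (continuous_samplingOp hc hg _))]
    have h1 : coeff (samplingOp (smolyakIndex d m) g) n =
        ∑ k ∈ smolyakIndex d m, coeff (q k g) n :=
      coeff_finset_sum _ (fun k _ => integrable_of_continuous (continuous_q_of_tsum hc hg k)) n
    have h2 : HasSum (fun l => coeff f l * (if l = n then 1 else 0 : ℂ)) (coeff f n) := by
      convert hasSum_single n fun l hl => ?_ using 1 <;> simp_all
    have h3 := h2.sub (hasSum_sum fun k (_ : k ∈ smolyakIndex d m) => hasSum_coeff_q hc hg k n)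
    rw [← h1] at h3
    simpa only [mul_sub, Finset.mul_sum] using h3
  rw [← hs.tsum_eq]
  refine enorm_tsum_le_tsum_enorm.trans (ENNReal.tsum_le_tsum fun l => ?_)
  rw [enorm_mul, ENNReal.tsum_mul_right, mul_comm]
  exact mul_le_mul_left (enorm_sub_sum_smolyak_le m l n) _

lemma hybridWeight_zero_mul_enorm_coeff_error_le {β : ℝ} (α : ℝ) (hβ : 0 ≤ β) (hf : MemLp f 2)
    (hc : Summable fun l => ‖coeff f l‖) (hg : ∀ x, g x = ∑' l, coeff f l * expo l x) (m : ℕ)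
    (n : Fin d → ℤ) :
    hybridWeight 0 β n * ‖coeff (fun x => f x - samplingOp (smolyakIndex d m) g x) n‖ₑ ≤
      2 ^ β * ∑' (l : Fin d → ℤ) (k : Fin d → ℕ),
        tailInd m k * (∏ j, etaAbs (k j) (l j) (n j)) *
          ((hybridWeight α β l * ‖coeff f l‖ₑ) * ∏ j, 2 ^ (-(α * level (l j)))) := by
  refine (mul_le_mul_right (enorm_coeff_error_le hf hc hg m n) _).trans ?_
  simp only [← ENNReal.tsum_mul_left]
  refine ENNReal.tsum_le_tsum fun l => ENNReal.tsum_le_tsum fun k => ?_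
  rw [mul_right_comm (hybridWeight α β l), hybridWeight_mul_prod]
  by_cases h0 : ∏ j, etaAbs (k j) (l j) (n j) = 0
  · simp [h0]
  -- Only nonvanishing kernel entries matter; for them `level n ≤ k + 1 ≤ level l + 1`, which lets
  -- the `β`-weight move from `n` to `l`.
  · have hj : ∀ j, level (n j) ≤ level (l j) + 1 := fun j => by
      have h1 := etaCoeff_ne_zero_of_etaAbs (Finset.prod_ne_zero_iff.1 h0 j (Finset.mem_univ j))
      have h2 := level_le_of_etaCoeff_ne_zero h1
      have h3 := le_level_of_etaCoeff_ne_zero h1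
      omega
    have hsup : supNorm (levels n) ≤ supNorm (levels l) + 1 := Finset.sup_le fun j _ =>
      (hj j).trans (Nat.succ_le_succ (Finset.le_sup (f := levels l) (Finset.mem_univ j)))
    have hw : hybridWeight 0 β n ≤ 2 ^ β * 2 ^ (β * (supNorm (levels l) : ℝ)) := by
      rw [hybridWeight, ← two_rpow_add]
      refine ENNReal.rpow_le_rpow_of_exponent_le (by norm_num) ?_
      have : (supNorm (levels n) : ℝ) ≤ supNorm (levels l) + 1 := by exact_mod_cast hsup
      nlinarith
    calc _ ≤ (2 ^ β * 2 ^ (β * (supNorm (levels l) : ℝ))) *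
          (tailInd m k * (∏ j, etaAbs (k j) (l j) (n j)) * ‖coeff f l‖ₑ) := by gcongr
      _ = _ := by ring

lemma exists_tsum_tailInd_le {α : ℝ} (hα : 0 < α) (hd : 1 ≤ d) :
    ∃ C : ℝ≥0∞, C ≠ ∞ ∧ ∀ m : ℕ, 1 ≤ m →
      ∑' k : Fin d → ℕ, tailInd m k * ∏ j, (2 : ℝ≥0∞) ^ (-(2 * α * k j)) ≤
        C * (2 ^ (-((m : ℝ) * α)) * ((m : ℝ≥0∞) ^ (((d : ℝ) - 1) / 2))) ^ 2 := by
  obtain ⟨d, rfl⟩ : ∃ d', d = d' + 1 := ⟨d - 1, by omega⟩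
  set x : ℝ≥0∞ := 2 ^ (-(2 * α)) with hx
  have hx1 : x < 1 := ENNReal.rpow_lt_one_of_one_lt_of_neg (by norm_num) (by linarith)
  obtain ⟨C, hC, h⟩ := exists_tsum_simplex_tail_le hx1 d
  -- The strict inequality `m < |k|_1` applies the simplex bound at `m + 1`, giving `(m + 2)^d`; `m
  -- + 2 ≤ 3m` is where `m ≥ 1` enters.
  refine ⟨C * 3 ^ d, ENNReal.mul_ne_top hC (by simp), fun m hm => ?_⟩
  have e1 : ∀ k : Fin (d + 1) → ℕ, tailInd m k * ∏ j, (2 : ℝ≥0∞) ^ (-(2 * α * k j)) =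
      if m + 1 ≤ ∑ j, k j then x ^ (∑ j, k j) else 0 := fun k => by
    rw [tailInd, ← Finset.prod_pow_eq_pow_sum]
    simp only [hx, ← ENNReal.rpow_natCast, ← ENNReal.rpow_mul, neg_mul, ite_mul, one_mul, zero_mul,
      Nat.succ_le_iff]
  have e2 : (2 ^ (-((m : ℝ) * α)) *
      ((m : ℝ≥0∞) ^ ((((d + 1 : ℕ) : ℝ) - 1) / 2))) ^ 2 = x ^ m * (m : ℝ≥0∞) ^ d := by
    rw [mul_pow, two_rpow_sq, hx]
    simp only [← ENNReal.rpow_natCast, ← ENNReal.rpow_mul]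
    congr 2
    · ring
    · push_cast
      ring
  rw [e2]
  simp only [e1]
  calc _ ≤ C * x ^ (m + 1) * ((m + 1 : ℕ) + 1) ^ d := h (m + 1)
    _ ≤ C * x ^ m * (3 * m) ^ d := by
        have h1 : x ^ (m + 1) ≤ x ^ m := pow_le_pow_of_le_one zero_le hx1.le (by omega)
        have h2 : ((m + 1 : ℕ) : ℝ≥0∞) + 1 ≤ 3 * m := by
          have : m + 1 + 1 ≤ 3 * m := by omega
          exact_mod_cast this
        gcongr
    _ = _ := by
        rw [mul_pow]
        ring

/-- The error estimate for the Smolyak operator. -/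
lemma exists_tsum_coeff_error_le {α β : ℝ} (hα : 1 / 2 < α) (hβ : 0 ≤ β) (hd : 1 ≤ d) :
    ∃ C : ℝ≥0∞, C ≠ ∞ ∧ ∀ f g : Torus d → ℂ, MemLp f 2 → (Summable fun l => ‖coeff f l‖) →
      (∀ x, g x = ∑' l, coeff f l * expo l x) → ∀ m : ℕ, 1 ≤ m →
      ∑' n, (hybridWeight 0 β n *
          ‖coeff (fun x => f x - samplingOp (smolyakIndex d m) g x) n‖ₑ) ^ 2 ≤
        C * (2 ^ (-((m : ℝ) * α)) * ((m : ℝ≥0∞) ^ (((d : ℝ) - 1) / 2))) ^ 2 *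
          ∑' l, (hybridWeight α β l * ‖coeff f l‖ₑ) ^ 2 := by
  obtain ⟨C₁, hC₁, h₁⟩ := exists_tsum_error_kernel_le hα d
  obtain ⟨C₂, hC₂, h₂⟩ := exists_tsum_tailInd_le (d := d) (α := α) (by linarith) hd
  refine ⟨(2 ^ β) ^ 2 * (C₁ * C₂), ENNReal.mul_ne_top (by simp) (ENNReal.mul_ne_top hC₁ hC₂),
    fun f g hf hc hg m hm => ?_⟩
  calc _ ≤ ∑' n : Fin d → ℤ, (2 ^ β) ^ 2 * (∑' (l : Fin d → ℤ) (k : Fin d → ℕ),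
        tailInd m k * (∏ j, etaAbs (k j) (l j) (n j)) *
          ((hybridWeight α β l * ‖coeff f l‖ₑ) * ∏ j, 2 ^ (-(α * level (l j))))) ^ 2 := by
        refine ENNReal.tsum_le_tsum fun n => ?_
        rw [← mul_pow]
        exact pow_le_pow_left₀ zero_le
          (hybridWeight_zero_mul_enorm_coeff_error_le α hβ hf hc hg m n) 2
    _ ≤ (2 ^ β) ^ 2 * (C₁ * (C₂ * (2 ^ (-((m : ℝ) * α)) *
          ((m : ℝ≥0∞) ^ (((d : ℝ) - 1) / 2))) ^ 2) *
          ∑' l, (hybridWeight α β l * ‖coeff f l‖ₑ) ^ 2) := by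
        rw [ENNReal.tsum_mul_left]
        gcongr
        refine (h₁ _ m).trans ?_
        gcongr
        exact h₂ m hm
    _ = _ := by ring

lemma exists_continuous_representative {d : ℕ} {f : Torus d → ℂ} (hf : MemLp f 2)
    (hc : Summable fun l => ‖coeff f l‖) : ∃ g : C(Torus d, ℂ), ⇑g =ᵐ[volume] f :=
  ⟨⟨fun x => ∑' k, coeff f k * expo k x, continuous_tsum_mul hc continuous_expo (B := 1) (by simp)⟩,
    (ae_eq_tsum_coeff hf hc).symm⟩

/-- Continuous functions that agree almost everywhere agree everywhere; pointwise equality is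
required because `g` is sampled at individual nodes. -/
lemma continuous_eq_tsum {d : ℕ} {f : Torus d → ℂ} (hf : MemLp f 2)
    (hc : Summable fun l => ‖coeff f l‖) (g : C(Torus d, ℂ)) (hg : ⇑g =ᵐ[volume] f) (x : Torus d) :
    g x = ∑' k, coeff f k * expo k x :=
  congrFun ((g.continuous.ae_eq_iff_eq volume (continuous_tsum_mul hc continuous_expo (B := 1)
    (by simp))).1 (hg.trans (ae_eq_tsum_coeff hf hc))) x

end SparseGrid

end

theorem theorem5 (d : ℕ) (hd : 1 ≤ d) (α β : ℝ) (hα : 1 / 2 < α) (hβ : 0 ≤ β) :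
    ∃ C : ℝ, 0 < C ∧
      ∀ f : SparseGrid.Torus d → ℂ, SparseGrid.MemH α β f →
        -- the representative of `f` that is sampled: the continuous one, which exists
        (∃ g : C(SparseGrid.Torus d, ℂ), ⇑g =ᵐ[volume] f) ∧
        ∀ g : C(SparseGrid.Torus d, ℂ), ⇑g =ᵐ[volume] f →
          ∀ m : ℕ, 1 ≤ m →
            SparseGrid.MemHIso β
              (fun x => f x - SparseGrid.samplingOp (SparseGrid.smolyakIndex d m) g x) ∧
            SparseGrid.isoNorm β
                (fun x => f x - SparseGrid.samplingOp (SparseGrid.smolyakIndex d m) g x) ≤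
              ENNReal.ofReal (C * (2 : ℝ) ^ (-((m : ℝ) * α)) * (m : ℝ) ^ (((d : ℝ) - 1) / 2)) *
                SparseGrid.hybridNorm α β f := by
  obtain ⟨K, hK, h⟩ := SparseGrid.exists_tsum_coeff_error_le (d := d) hα hβ hd
  have hK' : K ^ (1 / 2 : ℝ) ≠ ∞ := ENNReal.rpow_ne_top_of_nonneg (by norm_num) hK
  -- Adding `1` only secures strict positivity of the constant.
  refine ⟨(K ^ (1 / 2 : ℝ)).toReal + 1, by positivity, fun f hf => ?_⟩
  have hfin := SparseGrid.tsum_hybridWeight_lt_top (by linarith) hβ hf.2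
  have hc := SparseGrid.summable_coeff_of_tsum hα hβ hfin
  refine ⟨SparseGrid.exists_continuous_representative hf.1 hc, fun g hg m hm => ?_⟩
  have hgs := SparseGrid.continuous_eq_tsum hf.1 hc g hg
  have herr := h f g hf.1 hc hgs m hm
  have hm0 : (m : ℝ≥0∞) ≠ 0 := by exact_mod_cast (by omega : m ≠ 0)
  set R : ℝ≥0∞ := 2 ^ (-((m : ℝ) * α)) * ((m : ℝ≥0∞) ^ (((d : ℝ) - 1) / 2)) with hR
  have hRtop : R ≠ ∞ := ENNReal.mul_ne_top (by simp)
    (ENNReal.rpow_ne_top_of_ne_zero hm0 (ENNReal.natCast_ne_top m))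
  refine ⟨⟨hf.1.sub (SparseGrid.memLp_of_continuous
    (SparseGrid.continuous_samplingOp hc hgs _) 2), SparseGrid.sharpNorm_lt_top_of_tsum hβ
    (herr.trans_lt ?_)⟩, ?_⟩
  · exact ENNReal.mul_lt_top (ENNReal.mul_lt_top hK.lt_top (ENNReal.pow_lt_top hRtop.lt_top)) hfin
  · have hpos : (0 : ℝ) < m := by exact_mod_cast hm
    rw [SparseGrid.isoNorm, SparseGrid.hybridNorm_eq, SparseGrid.hybridNorm_eq]
    have hofR : ENNReal.ofReal (((K ^ (1 / 2 : ℝ)).toReal + 1) * (2 : ℝ) ^ (-((m : ℝ) * α)) *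
        (m : ℝ) ^ (((d : ℝ) - 1) / 2)) = (K ^ (1 / 2 : ℝ) + 1) * R := by
      rw [ENNReal.ofReal_mul (by positivity), ENNReal.ofReal_mul (by positivity),
        ENNReal.ofReal_add (by positivity) (by norm_num), ENNReal.ofReal_toReal hK',
        SparseGrid.ofReal_two_rpow, ← ENNReal.ofReal_rpow_of_pos hpos, ENNReal.ofReal_natCast,
        ENNReal.ofReal_one, hR, mul_assoc]
    rw [hofR]
    -- The volume factor from orthogonality occurs in both norms and is carried along unchanged.
    set V := ENNReal.ofReal ((2 * π) ^ d)
    set T := ∑' l, (SparseGrid.hybridWeight α β l * ‖SparseGrid.coeff f l‖ₑ) ^ 2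
    calc _ ≤ (V * (K * R ^ 2 * T)) ^ (1 / 2 : ℝ) := by gcongr
      _ = (K * R ^ 2 * (V * T)) ^ (1 / 2 : ℝ) := by rw [mul_left_comm]
      _ = K ^ (1 / 2 : ℝ) * R * (V * T) ^ (1 / 2 : ℝ) := by
          rw [ENNReal.mul_rpow_of_nonneg _ _ (by norm_num),
            ENNReal.mul_rpow_of_nonneg _ _ (by norm_num), ← ENNReal.rpow_natCast R,
            ← ENNReal.rpow_mul]
          norm_num
      _ ≤ _ := by
          gcongr
          exact le_self_add
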